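/- Let $\mathbb{D}$ be the open unit disc with the hyperbolic metric $\mathbf{g}=\frac{4(dx^2+dy^2)}{(1-|z|^2)^2}$, let $\mathrm{Isom}^+(\mathbb{D})$ be its group of orientation preserving isometries (with the compact-open topology), and let $\Gamma\le \mathrm{Isom}^+(\mathbb{D})$ be a discrete subgroup which is cocompact, i.e. $\mathbb{D}/\Gamma$ is compact. Vector fields on $\mathbb{D}$ are identified with functions $\mathbb{D}\to\mathbb{C}$, and $\gamma\in\mathrm{Isom}^+(\mathbb{D})$ acts on them by $\gamma^*X=(X\circ\gamma)\cdot(\gamma')^{-1}$. Let $\mathfrak{g}$ be the real vector space of Killing vector fields on $\mathbb{D}$, and let $H^1(\Gamma;\mathfrak{g})=Z^1(\Gamma;\mathfrak g)/B^1(\Gamma;\mathfrak g)$, where $Z^1(\Gamma;\mathfrak g)$ consists of the maps $c:\Gamma\to\mathfrak{g}$ with $c_{\gamma_1\gamma_2}=\gamma_2^*c_{\gamma_1}+c_{\gamma_2}$ and $B^1(\Gamma;\mathfrak g)$ of the maps $\gamma\mapsto\gamma^*X-X$ with $X\in\mathfrak{g}$. Let $\mathrm{HQD}(\mathbb{D},\Gamma)$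 be the vector space of holomorphic quadratic differentials $q=f\,dz^2$ on $\mathbb{D}$ with $f(\gamma(z))\gamma'(z)^2=f(z)$ for all $\gamma\in\Gamma$ and $z\in\mathbb{D}$. A smooth vector field $\xi$ on $\mathbb{D}$ is called harmonic if there is a smooth family of maps $\phi_t:\mathbb{D}\to\mathbb{D}$, $t\in[0,\epsilon)$, with $\phi_0=\mathrm{id}$, $\frac{d}{dt}\big|_{t=0}\phi_t=\xi$ and $\frac{d}{dt}\big|_{t=0}\tau(\phi_t)(z)=0$ for all $z\in\mathbb{D}$, where $\tau$ is the tension field. For a real symmetric bilinear form $h$ on $\mathbb{C}=\mathbb{R}^2$, let $h^{(2,0)}$ be the multiple of $dz^2$ whose real part is the trace-free part of $h$. Say that a vector field $\chi$ on $\mathbb{D}$ is associated with $q\in\mathrm{HQD}(\mathbb{D},\Gamma)$ if 1. $\chi$ is harmonic and $(\mathcal{L}_\chi\mathbf{g})^{(2,0)}=q$; 2. $\chi$ has an $L^2$-extension to $\overline{\mathbb{D}}$, i.e. the functions $w\mapsto\chi(rw)$ on $\mathbb{S}^1$ converge in $L^2(\mathbb{S}^1)$ as $r\to1^-$, and the limit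 is tangential to $\mathbb{S}^1$, i.e. of the form $w\mapsto a(w)\,iw$ with $a(w)\in\mathbb{R}$ for almost every $w$. Then every $q\in\mathrm{HQD}(\mathbb{D},\Gamma)$ has an associated vector field $\chi$; for every such $\chi$ the map $\delta\chi:\gamma\mapsto\gamma^*\chi-\chi$ is a $1$-cocycle with values in $\mathfrak{g}$; its class $[\delta\chi]\in H^1(\Gamma;\mathfrak{g})$ depends only on $q$; and the resulting map $$\varPhi:\mathrm{HQD}(\mathbb{D},\Gamma)\longrightarrow H^1(\Gamma;\mathfrak{g}),\qquad q\longmapsto[\delta\chi],$$ is injective. -/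

import Mathlib

open scoped ContDiff Complex.UnitDisc

noncomputable section

namespace HarmonicDisc

/-! ### The Poincaré disc -/

/-- The open unit disc as a subset of `ℂ`. -/
def disc : Set ℂ := Metric.ball 0 1

/-- Extension by zero of a function on the disc to `ℂ`; used only to take derivatives at points of
the (open) disc. -/
def discExt (F : 𝔻 → ℂ) : ℂ → ℂ :=
  fun z => if h : ‖z‖ < 1 then F (Complex.UnitDisc.mk z h) else 0

theorem discExt_coe (F : 𝔻 → ℂ) (z : 𝔻) : discExt F (z : ℂ) = F z := by
  simp [discExt, z.norm_lt_one]

theorem coe_mem_disc (z : 𝔻) : (z : ℂ) ∈ disc := by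
  simpa [disc] using z.norm_lt_one

theorem isOpen_disc : IsOpen disc := Metric.isOpen_ball

theorem disc_mem_nhds (z : 𝔻) : disc ∈ nhds (z : ℂ) := isOpen_disc.mem_nhds (coe_mem_disc z)

theorem discExt_add (F G : 𝔻 → ℂ) : discExt (F + G) = discExt F + discExt G := by
  funext z; by_cases h : ‖z‖ < 1 <;> simp [discExt, h]

theorem discExt_zero : discExt 0 = 0 := by
  funext z; by_cases h : ‖z‖ < 1 <;> simp [discExt, h]

theorem discExt_smul {R : Type*} [SMulZeroClass R ℂ] (a : R) (F : 𝔻 → ℂ) :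
    discExt (a • F) = a • discExt F := by
  funext z; by_cases h : ‖z‖ < 1 <;> simp [discExt, h]

/-- The hyperbolic metric `4 (dx² + dy²) / (1 - |z|²)²`, as a field of bilinear forms. -/
def discMetric (z v w : ℂ) : ℝ := 4 / (1 - ‖z‖ ^ 2) ^ 2 * inner ℝ v w

/-- A self-map of the disc, viewed as a `ℂ`-valued function near the disc. -/
def mapExt (γ : 𝔻 → 𝔻) : ℂ → ℂ := discExt (fun z => (γ z : ℂ))

theorem mapExt_coe (γ : 𝔻 → 𝔻) (z : 𝔻) : mapExt γ (z : ℂ) = γ z := discExt_coe _ z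

theorem mapExt_mapsTo (γ : 𝔻 → 𝔻) : Set.MapsTo (mapExt γ) disc disc := by
  intro z hz
  have hz' : ‖z‖ < 1 := by simpa [disc] using hz
  have := mapExt_coe γ (Complex.UnitDisc.mk z hz')
  rw [Complex.UnitDisc.coe_mk] at this
  rw [this]; exact coe_mem_disc _

theorem mapExt_comp (γ δ : 𝔻 → 𝔻) :
    Set.EqOn (mapExt (γ ∘ δ)) (mapExt γ ∘ mapExt δ) disc := by
  intro z hz
  have hz' : ‖z‖ < 1 := by simpa [disc] using hz
  obtain ⟨w, rfl⟩ : ∃ w : 𝔻, (w : ℂ) = z := ⟨Complex.UnitDisc.mk z hz', rfl⟩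
  simp only [Function.comp, mapExt_coe]

theorem mapExt_id : Set.EqOn (mapExt (id : 𝔻 → 𝔻)) id disc := by
  intro z hz
  have hz' : ‖z‖ < 1 := by simpa [disc] using hz
  obtain ⟨w, rfl⟩ : ∃ w : 𝔻, (w : ℂ) = z := ⟨Complex.UnitDisc.mk z hz', rfl⟩
  simp only [mapExt_coe, id]

/-- Orientation preserving Riemannian isometries of the Poincaré disc: diffeomorphisms which
preserve the hyperbolic metric and have positive Jacobian determinant. -/
structure IsOrientedIsometry (γ : 𝔻 ≃ₜ 𝔻) : Prop where
  smooth : ContDiffOn ℝ ∞ (mapExt γ) disc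
  smooth_symm : ContDiffOn ℝ ∞ (mapExt γ.symm) disc
  preserves_metric : ∀ (z : 𝔻) (v w : ℂ),
    discMetric (γ z) (fderiv ℝ (mapExt γ) z v) (fderiv ℝ (mapExt γ) z w) = discMetric z v w
  preserves_orientation : ∀ z : 𝔻, 0 < (fderiv ℝ (mapExt γ) z).det

theorem differentiableAt_of_contDiffOn {F : ℂ → ℂ} (h : ContDiffOn ℝ ∞ F disc) (z : 𝔻) :
    DifferentiableAt ℝ F z :=
  (h.contDiffAt (disc_mem_nhds z)).differentiableAt (by simp)

theorem fderiv_mapExt_comp {γ δ : 𝔻 → 𝔻} (hγ : ContDiffOn ℝ ∞ (mapExt γ) disc)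
    (hδ : ContDiffOn ℝ ∞ (mapExt δ) disc) (z : 𝔻) :
    fderiv ℝ (mapExt (γ ∘ δ)) z
      = (fderiv ℝ (mapExt γ) (δ z)).comp (fderiv ℝ (mapExt δ) z) := by
  have h : mapExt (γ ∘ δ) =ᶠ[nhds (z : ℂ)] mapExt γ ∘ mapExt δ :=
    (mapExt_comp γ δ).eventuallyEq_of_mem (disc_mem_nhds z)
  have hd : DifferentiableAt ℝ (mapExt γ) (mapExt δ z) := by
    rw [mapExt_coe]; exact differentiableAt_of_contDiffOn hγ (δ z)
  rw [h.fderiv_eq, fderiv_comp _ hd (differentiableAt_of_contDiffOn hδ z), mapExt_coe]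

theorem fderiv_mapExt_id (z : 𝔻) :
    fderiv ℝ (mapExt (id : 𝔻 → 𝔻)) z = ContinuousLinearMap.id ℝ ℂ := by
  rw [(mapExt_id.eventuallyEq_of_mem (disc_mem_nhds z)).fderiv_eq, fderiv_id]

theorem contDiffOn_mapExt_comp {γ δ : 𝔻 → 𝔻} (hγ : ContDiffOn ℝ ∞ (mapExt γ) disc)
    (hδ : ContDiffOn ℝ ∞ (mapExt δ) disc) : ContDiffOn ℝ ∞ (mapExt (γ ∘ δ)) disc :=
  (hγ.comp hδ (mapExt_mapsTo δ)).congr (mapExt_comp γ δ)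

theorem IsOrientedIsometry.one : IsOrientedIsometry (1 : 𝔻 ≃ₜ 𝔻) := by
  have h : ContDiffOn ℝ ∞ (mapExt (id : 𝔻 → 𝔻)) disc := contDiffOn_id.congr mapExt_id
  refine ⟨h, h, fun z v w => ?_, fun z => ?_⟩
  · change discMetric z (fderiv ℝ (mapExt (id : 𝔻 → 𝔻)) z v)
      (fderiv ℝ (mapExt (id : 𝔻 → 𝔻)) z w) = _
    rw [fderiv_mapExt_id]; rfl
  · change 0 < (fderiv ℝ (mapExt (id : 𝔻 → 𝔻)) z).det
    rw [fderiv_mapExt_id]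
    simp [ContinuousLinearMap.det]

theorem IsOrientedIsometry.mul {γ δ : 𝔻 ≃ₜ 𝔻} (hγ : IsOrientedIsometry γ)
    (hδ : IsOrientedIsometry δ) : IsOrientedIsometry (γ * δ) := by
  have hc : ∀ z : 𝔻, fderiv ℝ (mapExt (γ * δ : 𝔻 ≃ₜ 𝔻)) z
      = (fderiv ℝ (mapExt γ) (δ z)).comp (fderiv ℝ (mapExt δ) z) :=
    fun z => fderiv_mapExt_comp hγ.smooth hδ.smooth z
  refine ⟨contDiffOn_mapExt_comp (γ := γ) (δ := δ) hγ.smooth hδ.smooth,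
    contDiffOn_mapExt_comp (γ := δ.symm) (δ := γ.symm) hδ.smooth_symm hγ.smooth_symm, fun z v w => ?_, fun z => ?_⟩
  · rw [hc]
    exact (hγ.preserves_metric (δ z) _ _).trans (hδ.preserves_metric z v w)
  · rw [hc]
    have : ((fderiv ℝ (mapExt γ) (δ z)).comp (fderiv ℝ (mapExt δ) z)).det
        = (fderiv ℝ (mapExt γ) (δ z)).det * (fderiv ℝ (mapExt δ) z).det := by
      simp [ContinuousLinearMap.det, LinearMap.det_comp]
    rw [this]
    exact mul_pos (hγ.preserves_orientation _) (hδ.preserves_orientation _)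

theorem IsOrientedIsometry.inv {γ : 𝔻 ≃ₜ 𝔻} (hγ : IsOrientedIsometry γ) :
    IsOrientedIsometry γ⁻¹ := by
  have hc : ∀ z : 𝔻, (fderiv ℝ (mapExt γ) (γ.symm z)).comp (fderiv ℝ (mapExt γ.symm) z)
      = ContinuousLinearMap.id ℝ ℂ := by
    intro z
    rw [← fderiv_mapExt_comp hγ.smooth hγ.smooth_symm z, ← fderiv_mapExt_id z]
    congr 2
    funext w
    simp
  refine ⟨hγ.smooth_symm, hγ.smooth, fun z v w => ?_, fun z => ?_⟩
  · change discMetric (γ.symm z) (fderiv ℝ (mapExt γ.symm) z v)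
      (fderiv ℝ (mapExt γ.symm) z w) = _
    have h := hγ.preserves_metric (γ.symm z) (fderiv ℝ (mapExt γ.symm) z v)
      (fderiv ℝ (mapExt γ.symm) z w)
    have hv : ∀ u, fderiv ℝ (mapExt γ) (γ.symm z) (fderiv ℝ (mapExt γ.symm) z u) = u :=
      fun u => congrArg (fun L : ℂ →L[ℝ] ℂ => L u) (hc z)
    rw [hv, hv, γ.apply_symm_apply] at h
    exact h.symm
  · change 0 < (fderiv ℝ (mapExt γ.symm) z).det
    have h : (fderiv ℝ (mapExt γ) (γ.symm z)).det * (fderiv ℝ (mapExt γ.symm) z).det = 1 := by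
      have := congrArg ContinuousLinearMap.det (hc z)
      simpa [ContinuousLinearMap.det, LinearMap.det_comp] using this
    exact pos_of_mul_pos_right (h ▸ one_pos) (hγ.preserves_orientation _).le

/-- The group `Isom⁺(𝔻)` of orientation preserving isometries of the Poincaré disc. -/
def IsomPlus : Subgroup (𝔻 ≃ₜ 𝔻) where
  carrier := {γ | IsOrientedIsometry γ}
  one_mem' := IsOrientedIsometry.one
  mul_mem' := IsOrientedIsometry.mul
  inv_mem' := IsOrientedIsometry.inv

/-- `Isom⁺(𝔻)` carries the compact-open topology. -/
instance instTopologicalSpaceIsomPlus : TopologicalSpace IsomPlus :=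
  TopologicalSpace.induced (fun γ => (⟨γ.1, γ.1.continuous⟩ : C(𝔻, 𝔻))) inferInstance

/-- The tautological action of `Isom⁺(𝔻)` on the disc. -/
instance instMulActionIsomPlus : MulAction IsomPlus 𝔻 where
  smul γ z := γ.1 z
  one_smul _ := rfl
  mul_smul _ _ _ := rfl

/-- The complex derivative `γ'(z)` of an (automatically holomorphic) orientation preserving
isometry. -/
def isomDeriv (γ : IsomPlus) (z : 𝔻) : ℂ := deriv (mapExt γ.1) z

/-! ### Vector fields and quadratic differentials -/

/-- A vector field on the disc is a function `𝔻 → ℂ`, by means of `T_z 𝔻 = ℂ`. -/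
def IsSmooth (X : 𝔻 → ℂ) : Prop := ContDiffOn ℝ ∞ (discExt X) disc

/-- The action `γ^* X = X(γ) γ'⁻¹` on vector fields. -/
def pullback (γ : IsomPlus) (X : 𝔻 → ℂ) : 𝔻 → ℂ := fun z => X (γ • z) * (isomDeriv γ z)⁻¹

/-- The Lie derivative `L_X g` of the hyperbolic metric, at `z`, evaluated at `(v, w)`. -/
def lieMetric (X : 𝔻 → ℂ) (z : 𝔻) (v w : ℂ) : ℝ :=
  fderiv ℝ (fun p => discMetric p v w) z (X z)
    + discMetric z (fderiv ℝ (discExt X) z v) w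
    + discMetric z v (fderiv ℝ (discExt X) z w)

/-- The coefficient `f` of the quadratic differential `f dz²` whose real part is the trace-free
part of the symmetric bilinear form `h`, that is `f = TF₁₁ - i TF₁₂`. -/
def quadraticPart (h : ℂ → ℂ → ℝ) : ℂ :=
  (((h 1 1 - h Complex.I Complex.I) / 2 : ℝ) : ℂ) - Complex.I * ((h 1 Complex.I : ℝ) : ℂ)

theorem lieMetric_add {X Y : 𝔻 → ℂ} (hX : IsSmooth X) (hY : IsSmooth Y) (z : 𝔻) (v w : ℂ) :
    lieMetric (X + Y) z v w = lieMetric X z v w + lieMetric Y z v w := by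
  simp only [lieMetric, discExt_add, Pi.add_apply,
    fderiv_add (differentiableAt_of_contDiffOn hX z) (differentiableAt_of_contDiffOn hY z),
    map_add, add_apply, discMetric, inner_add_left, inner_add_right]
  ring

theorem lieMetric_smul {X : 𝔻 → ℂ} (hX : IsSmooth X) (a : ℝ) (z : 𝔻) (v w : ℂ) :
    lieMetric (a • X) z v w = a * lieMetric X z v w := by
  simp only [lieMetric, discExt_smul, Pi.smul_apply,
    fderiv_const_smul (differentiableAt_of_contDiffOn hX z) a, map_smul,
    smul_apply, discMetric, real_inner_smul_left, real_inner_smul_right,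
    smul_eq_mul]
  ring

/-- The Lie algebra `𝔤` of `Isom⁺(𝔻)`: the Killing vector fields on the Poincaré disc. -/
def killing : Submodule ℝ (𝔻 → ℂ) where
  carrier := {X | IsSmooth X ∧ ∀ (z : 𝔻) (v w : ℂ), lieMetric X z v w = 0}
  zero_mem' := by
    refine ⟨?_, fun z v w => ?_⟩
    · change ContDiffOn ℝ ∞ (discExt 0) disc
      rw [discExt_zero]; exact contDiffOn_const
    · simp [lieMetric, discExt_zero, discMetric]
  add_mem' := by
    rintro X Y ⟨hX, hX'⟩ ⟨hY, hY'⟩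
    refine ⟨?_, fun z v w => ?_⟩
    · change ContDiffOn ℝ ∞ (discExt (X + Y)) disc
      rw [discExt_add]; exact ContDiffOn.add hX hY
    · rw [lieMetric_add hX hY, hX', hY', add_zero]
  smul_mem' := by
    rintro a X ⟨hX, hX'⟩
    refine ⟨?_, fun z v w => ?_⟩
    · change ContDiffOn ℝ ∞ (discExt (a • X)) disc
      rw [discExt_smul]; exact ContDiffOn.const_smul a hX
    · rw [lieMetric_smul hX, hX', mul_zero]

/-- `HQD(𝔻, Γ)`: the `Γ`-invariant holomorphic quadratic differentials `f dz²` on the disc. -/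
def HQD (Γ : Subgroup IsomPlus) : Submodule ℂ (𝔻 → ℂ) where
  carrier := {f | DifferentiableOn ℂ (discExt f) disc ∧
    ∀ γ ∈ Γ, ∀ z : 𝔻, f (γ • z) * isomDeriv γ z ^ 2 = f z}
  zero_mem' := by
    refine ⟨?_, fun γ _ z => by simp⟩
    rw [discExt_zero]; exact differentiableOn_const 0
  add_mem' := by
    rintro f g ⟨hf, hf'⟩ ⟨hg, hg'⟩
    refine ⟨?_, fun γ hγ z => ?_⟩
    · rw [discExt_add]; exact DifferentiableOn.add hf hg
    · simp only [Pi.add_apply, add_mul, hf' γ hγ z, hg' γ hγ z]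
  smul_mem' := by
    rintro a f ⟨hf, hf'⟩
    refine ⟨?_, fun γ hγ z => ?_⟩
    · rw [discExt_smul]; exact DifferentiableOn.const_smul hf a
    · simp only [Pi.smul_apply, smul_eq_mul, mul_assoc, hf' γ hγ z]

/-! ### Harmonic vector fields -/

/-- The coordinate basis `1, i` of `ℂ = ℝ²`. -/
def coordVec (i : Fin 2) : ℂ := ![1, Complex.I] i

/-- The coordinates `x¹ = re`, `x² = im` on `ℂ = ℝ²`. -/
def coord (i : Fin 2) (z : ℂ) : ℝ := ![z.re, z.im] i

/-- The partial derivative `∂F/∂xⁱ`. -/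
def partialD (i : Fin 2) (F : ℂ → ℝ) (z : ℂ) : ℝ := fderiv ℝ F z (coordVec i)

/-- The matrix `g_ij` of the hyperbolic metric. -/
def metricMatrix (z : ℂ) : Matrix (Fin 2) (Fin 2) ℝ :=
  Matrix.of fun i j => discMetric z (coordVec i) (coordVec j)

/-- The Christoffel symbols `Γᵏ_ij` of the Levi-Civita connection of the hyperbolic metric. -/
def christoffel (k i j : Fin 2) (z : ℂ) : ℝ :=
  (1 / 2) * ∑ l, (metricMatrix z)⁻¹ k l *
    (partialD i (fun p => metricMatrix p j l) z + partialD j (fun p => metricMatrix p i l) z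
      - partialD l (fun p => metricMatrix p i j) z)

/-- The tension field `τ(φ)`, in coordinates, of a map `φ` from the Poincaré disc to itself. -/
def tension (φ : ℂ → ℂ) (a : Fin 2) (z : ℂ) : ℝ :=
  ∑ i, ∑ j, (metricMatrix z)⁻¹ i j *
    (partialD i (partialD j (fun p => coord a (φ p))) z
      - ∑ k, christoffel k i j z * partialD k (fun p => coord a (φ p)) z
      + ∑ b, ∑ c, christoffel a b c (φ z) *
          partialD i (fun p => coord b (φ p)) z * partialD j (fun p => coord c (φ p)) z)

/-- A smooth vector field `ξ` is harmonic if it is the initial velocity of a smooth family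
`φ_t : 𝔻 → 𝔻`, `t ∈ [0, ε)`, with `φ_0 = id` and with `d/dt τ(φ_t)(z) = 0` at `t = 0` for all
`z`. -/
def IsHarmonic (ξ : 𝔻 → ℂ) : Prop :=
  IsSmooth ξ ∧ ∃ ε : ℝ, 0 < ε ∧ ∃ φ : ℝ → 𝔻 → 𝔻,
    ContDiffOn ℝ ∞ (fun p : ℝ × ℂ => mapExt (φ p.1) p.2) (Set.Ico 0 ε ×ˢ disc) ∧
    (∀ z, φ 0 z = z) ∧
    (∀ z : 𝔻, HasDerivWithinAt (fun t => (φ t z : ℂ)) (ξ z) (Set.Ico 0 ε) 0) ∧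
    ∀ (z : 𝔻) (a : Fin 2),
      HasDerivWithinAt (fun t => tension (mapExt (φ t)) a z) 0 (Set.Ico 0 ε) 0

/-! ### Boundary values -/

/-- `X` has the `L²`-extension `Y` to the boundary circle: the restrictions of `X` to the circles of
radius `r < 1`, rescaled to the unit circle, converge to `Y` in `L²` as `r → 1`. -/
def HasL2Extension (X : 𝔻 → ℂ) (Y : Circle → ℂ) : Prop :=
  MeasureTheory.MemLp (fun θ : ℝ => Y (Circle.exp θ)) 2
    (MeasureTheory.volume.restrict (Set.Ioc 0 (2 * Real.pi))) ∧
  Filter.Tendsto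
    (fun r : ℝ => MeasureTheory.eLpNorm
      (fun θ : ℝ => discExt X (r * Circle.exp θ) - Y (Circle.exp θ)) 2
      (MeasureTheory.volume.restrict (Set.Ioc 0 (2 * Real.pi))))
    (nhdsWithin 1 (Set.Iio 1)) (nhds 0)

/-- A vector field on the circle is tangential if it is a real multiple of `w ↦ i w` almost
everywhere. -/
def IsTangential (Y : Circle → ℂ) : Prop :=
  ∀ᵐ θ : ℝ ∂(MeasureTheory.volume.restrict (Set.Ioc 0 (2 * Real.pi))),
    ∃ a : ℝ, Y (Circle.exp θ) = a * (Complex.I * Circle.exp θ)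

/-- The relation between `q = f dz²` and `χ`: `χ` is a harmonic vector field on the disc with
`(L_χ g)^(2,0) = q`, and it has an `L²`-extension to the closed disc whose restriction to the
boundary circle is tangential. -/
structure IsPotential (f χ : 𝔻 → ℂ) : Prop where
  harmonic : IsHarmonic χ
  quadratic : ∀ z : 𝔻, quadraticPart (lieMetric χ z) = f z
  boundary : ∃ Y : Circle → ℂ, HasL2Extension χ Y ∧ IsTangential Y

/-! ### Group cohomology with coefficients in the Killing vector fields -/

theorem pullback_add (γ : IsomPlus) (X Y : 𝔻 → ℂ) :
    pullback γ (X + Y) = pullback γ X + pullback γ Y := by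
  funext z; simp [pullback, add_mul]

theorem pullback_smul (γ : IsomPlus) (a : ℝ) (X : 𝔻 → ℂ) :
    pullback γ (a • X) = a • pullback γ X := by
  funext z; simp [pullback, mul_assoc]

theorem pullback_zero (γ : IsomPlus) : pullback γ 0 = 0 := by
  funext z; simp [pullback]

/-- The coboundary `δX : γ ↦ γ^* X - X` of a vector field. -/
def coboundary (X : 𝔻 → ℂ) (γ : IsomPlus) : 𝔻 → ℂ := pullback γ X - X

/-- The `1`-cocycles `Z¹(Γ; 𝔤)`: maps `c : Γ → 𝔤` with `c(γ₁ γ₂) = γ₂^* c(γ₁) + c(γ₂)`. -/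
def Z1 (Γ : Subgroup IsomPlus) : Submodule ℝ (Γ → 𝔻 → ℂ) where
  carrier := {c | (∀ γ, c γ ∈ killing) ∧
    ∀ γ₁ γ₂ : Γ, c (γ₁ * γ₂) = pullback γ₂ (c γ₁) + c γ₂}
  zero_mem' := ⟨fun _ => killing.zero_mem, fun γ₁ γ₂ => by simp [pullback_zero]⟩
  add_mem' := by
    rintro c d ⟨hc, hc'⟩ ⟨hd, hd'⟩
    refine ⟨fun γ => killing.add_mem (hc γ) (hd γ), fun γ₁ γ₂ => ?_⟩
    simp only [Pi.add_apply, hc' γ₁ γ₂, hd' γ₁ γ₂, pullback_add]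
    abel
  smul_mem' := by
    rintro a c ⟨hc, hc'⟩
    refine ⟨fun γ => killing.smul_mem a (hc γ), fun γ₁ γ₂ => ?_⟩
    simp only [Pi.smul_apply, hc' γ₁ γ₂, pullback_smul, smul_add]

/-- The `1`-coboundaries `B¹(Γ; 𝔤)`: the cocycles `δX` with `X ∈ 𝔤`. -/
def B1 (Γ : Subgroup IsomPlus) : Submodule ℝ (Z1 Γ) where
  carrier := {c | ∃ X ∈ killing, ∀ γ : Γ, c.1 γ = coboundary X γ}
  zero_mem' := ⟨0, killing.zero_mem, fun γ => by simp [coboundary, pullback_zero]⟩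
  add_mem' := by
    rintro c d ⟨X, hX, hc⟩ ⟨Y, hY, hd⟩
    refine ⟨X + Y, killing.add_mem hX hY, fun γ => ?_⟩
    simp only [Submodule.coe_add, Pi.add_apply, hc γ, hd γ, coboundary, pullback_add]
    abel
  smul_mem' := by
    rintro a c ⟨X, hX, hc⟩
    refine ⟨a • X, killing.smul_mem a hX, fun γ => ?_⟩
    simp only [Submodule.coe_smul, Pi.smul_apply, hc γ, coboundary, pullback_smul, smul_sub]

/-- The first cohomology group `H¹(Γ; 𝔤) = Z¹(Γ; 𝔤) / B¹(Γ; 𝔤)`. -/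
abbrev H1 (Γ : Subgroup IsomPlus) : Type := Z1 Γ ⧸ B1 Γ

end HarmonicDisc

end

/-! In the coordinate `z`, the condition `(L_χ g)^(2,0) = f dz²` is a Cauchy-Riemann equation,
`∂χ/∂z̄ = (1 - |z|²)² f̄ / 8`. It has explicit solutions: choose a holomorphic `F` with `F''' = f`
and form `eichlerField F`, a real-linear combination of `F` and the conjugates of `F`, `F'`, `F''`,
in which the `z̄`-derivatives telescope. Any solution of this equation with `f` holomorphic is
harmonic, because the linearized tension field then vanishes (`linearized_tension_eq_zero`).

Cocompactness bounds `|f| (1 - |z|²)²`. Integrating along radii, `F` extends to the circle with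
values `Y`, and `eichlerField F` has boundary values `(w² Ȳ - Y) / 4`, which are tangential. This
gives existence. Conversely, two solutions differ by a holomorphic field with tangential `L²`
boundary values. Tangentiality links the Fourier coefficients of index `n` and `2 - n`, and those of
negative index vanish, so only `b + c z - b̄ z²` with `c` imaginary remains, a Killing field
(`eq_quadratic_of_isTangential`). Since `eichlerField` of quadratic polynomials produces all such
fields, every potential is `eichlerField F` for some third primitive `F`.

The cocycle property is Bol's lemma: `(F ∘ γ) / γ'` has third derivative `(f ∘ γ) γ'²`, which equals
`f` for invariant `f`, and this operation is compatible with `eichlerField`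
(`IsThirdPrimitive.exists_pullback`). Hence `γ^*χ - χ` comes from a quadratic polynomial and is
Killing.

For injectivity, cohomologous cocycles make `X = χ₁ - χ₂ - K` a `Γ`-invariant field for some Killing
`K`. By cocompactness its hyperbolic length is bounded, so `X` tends to `0` at the circle. Writing
`X` as `eichlerField F` with `F''' = f₁ - f₂`, the boundary values `Y` of `F` satisfy `w² Ȳ = Y`, so
`i F` has tangential boundary values. The same Fourier argument makes `F` quadratic, whence `f₁ =
f₂`. -/

namespace HarmonicDisc

open Complex ComplexConjugate Filter Topology Set MeasureTheory

/-! ### Orientation preserving isometries are Möbius transformations -/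

theorem mem_disc {z : ℂ} : z ∈ disc ↔ ‖z‖ < 1 := by simp [disc]

theorem discExt_of_norm_lt (F : 𝔻 → ℂ) {z : ℂ} (hz : ‖z‖ < 1) :
    discExt F z = F (UnitDisc.mk z hz) := by simp [discExt, hz]

theorem det_real_linear (L : ℂ →L[ℝ] ℂ) :
    L.det = (L 1).re * (L I).im - (L I).re * (L 1).im := by
  rw [ContinuousLinearMap.det, ← LinearMap.det_toMatrix Complex.basisOneI, Matrix.det_fin_two]
  simp [LinearMap.toMatrix_apply]

/-- The images of `1` and `i` are orthogonal of squared length `c`, so the determinant squares to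
`c²` and, being positive, equals `c`. The two Cauchy-Riemann defects then have sum of squares `2c -
2 det = 0`. -/
theorem eq_I_mul_of_conformal {L : ℂ →L[ℝ] ℂ} {c : ℝ} (hc : 0 < c)
    (h : ∀ v w, inner ℝ (L v) (L w) = c * inner ℝ v w) (hdet : 0 < L.det) :
    L I = I * L 1 ∧ ‖L 1‖ ^ 2 = c := by
  rw [det_real_linear] at hdet
  have h1 := h 1 1
  have h2 := h I I
  have h3 := h 1 I
  simp only [Complex.inner, mul_re, conj_re, conj_im, one_re, one_im, I_re, I_im] at h1 h2 h3
  set p := (L 1).re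
  set q := (L 1).im
  set r := (L I).re
  set s := (L I).im
  have e1 : p * p + q * q = c := by linarith
  have e2 : r * r + s * s = c := by linarith
  have e3 : p * r + q * s = 0 := by linarith
  have hD : p * s - r * q = c := by
    have : (p * s - r * q) ^ 2 = c ^ 2 := by
      linear_combination (r * r + s * s) * e1 + c * e2 - (p * r + q * s) * e3
    exact (pow_left_inj₀ hdet.le hc.le two_ne_zero).1 this
  have hz : (p - s) ^ 2 + (q + r) ^ 2 = 0 := by linear_combination e1 + e2 - 2 * hD
  have hps : p - s = 0 := by nlinarith [sq_nonneg (p - s), sq_nonneg (q + r)]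
  have hqr : q + r = 0 := by nlinarith [sq_nonneg (p - s), sq_nonneg (q + r)]
  refine ⟨Complex.ext ?_ ?_, ?_⟩
  · simp only [mul_re, I_re, I_im]
    change r = 0 * p - 1 * q
    linarith
  · simp only [mul_im, I_re, I_im]
    change s = 0 * q + 1 * p
    linarith
  · rw [← normSq_eq_norm_sq, normSq_apply]
    exact e1

theorem one_sub_norm_sq_pos (z : 𝔻) : 0 < 1 - ‖(z : ℂ)‖ ^ 2 := by
  linarith [z.sq_norm_lt_one]

theorem isomPlus_fderiv (γ : IsomPlus) (z : 𝔻) :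
    fderiv ℝ (mapExt γ.1) z I = I * fderiv ℝ (mapExt γ.1) z 1 ∧
      ‖fderiv ℝ (mapExt γ.1) z 1‖ ^ 2 =
        ((1 - ‖((γ • z : 𝔻) : ℂ)‖ ^ 2) / (1 - ‖(z : ℂ)‖ ^ 2)) ^ 2 := by
  have hp := one_sub_norm_sq_pos z
  have hq := one_sub_norm_sq_pos (γ • z)
  refine eq_I_mul_of_conformal (by positivity) (fun v w => ?_) (γ.2.preserves_orientation z)
  have := γ.2.preserves_metric z v w
  simp only [discMetric] at this
  change 4 / (1 - ‖((γ • z : 𝔻) : ℂ)‖ ^ 2) ^ 2 * _ = _ at this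
  field_simp at this ⊢
  linarith

theorem hasDerivAt_mapExt (γ : IsomPlus) (z : 𝔻) :
    HasDerivAt (mapExt γ.1) (isomDeriv γ z) z := by
  refine DifferentiableAt.hasDerivAt (differentiableAt_complex_iff_differentiableAt_real.2
    ⟨differentiableAt_of_contDiffOn γ.2.smooth z, ?_⟩)
  rw [smul_eq_mul]
  exact (isomPlus_fderiv γ z).1

theorem norm_isomDeriv (γ : IsomPlus) (z : 𝔻) :
    ‖isomDeriv γ z‖ = (1 - ‖((γ • z : 𝔻) : ℂ)‖ ^ 2) / (1 - ‖(z : ℂ)‖ ^ 2) := by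
  have hp := one_sub_norm_sq_pos z
  have hq := one_sub_norm_sq_pos (γ • z)
  have h : isomDeriv γ z = fderiv ℝ (mapExt γ.1) z 1 := by
    rw [(hasDerivAt_mapExt γ z).complexToReal_fderiv.fderiv]
    simp
  rw [h]
  exact (pow_left_inj₀ (norm_nonneg _) (by positivity) two_ne_zero).1 (isomPlus_fderiv γ z).2

theorem isomDeriv_mul (γ δ : IsomPlus) (z : 𝔻) :
    isomDeriv (γ * δ) z = isomDeriv γ (δ • z) * isomDeriv δ z := by
  have h : mapExt (γ * δ).1 =ᶠ[𝓝 (z : ℂ)] mapExt γ.1 ∘ mapExt δ.1 :=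
    (mapExt_comp γ.1 δ.1).eventuallyEq_of_mem (disc_mem_nhds z)
  have h1 : HasDerivAt (mapExt γ.1) (isomDeriv γ (δ • z)) (mapExt δ.1 z) := by
    rw [mapExt_coe]
    exact hasDerivAt_mapExt γ (δ • z)
  rw [isomDeriv, h.deriv_eq]
  exact (h1.comp (z : ℂ) (hasDerivAt_mapExt δ z)).deriv

theorem one_add_ne_zero_of_norm_lt {w : ℂ} (hw : ‖w‖ < 1) : 1 + w ≠ 0 := by
  intro h
  rw [eq_neg_of_add_eq_zero_right h] at hw
  simp at hw

/-- The difference of the squares is `(1 - |b|²)(1 - |w|²)`. -/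
theorem norm_sub_lt_norm_one_sub {b w : ℂ} (hb : ‖b‖ < 1) (hw : ‖w‖ < 1) :
    ‖w - b‖ < ‖1 - conj b * w‖ := by
  refine lt_of_pow_lt_pow_left₀ 2 (norm_nonneg _) ?_
  have h1 : 0 < 1 - ‖b‖ ^ 2 := by nlinarith [norm_nonneg b]
  have h2 : 0 < 1 - ‖w‖ ^ 2 := by nlinarith [norm_nonneg w]
  have h3 := mul_pos h1 h2
  rw [← normSq_eq_norm_sq, ← normSq_eq_norm_sq] at *
  simp only [normSq_apply, sub_re, sub_im, mul_re, mul_im, conj_re, conj_im, one_re, one_im] at *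
  nlinarith

/-- Composing `γ` with the disc automorphism that moves `γ 0` to `0` gives a holomorphic self-map
`g` fixing `0`. Preservation of the metric at `0` forces `|g' 0| = 1`, so the equality case of the
Schwarz lemma makes `g` a rotation; solving for `γ z` gives the formula. -/
theorem exists_moebius (γ : IsomPlus) : ∃ α b : ℂ, ‖α‖ = 1 ∧ ‖b‖ < 1 ∧
    ∀ z : 𝔻, ((γ • z : 𝔻) : ℂ) = (α * z + b) / (1 + conj b * α * z) := by
  set b : ℂ := ((γ • (0 : 𝔻) : 𝔻) : ℂ) with hb
  have hb1 : ‖b‖ < 1 := (γ • (0 : 𝔻)).norm_lt_one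
  set g : ℂ → ℂ := fun z => (mapExt γ.1 z - b) / (1 - conj b * mapExt γ.1 z) with hg
  have hmaps : ∀ z ∈ disc, ‖mapExt γ.1 z‖ < 1 := fun z hz => mem_disc.1 (mapExt_mapsTo γ.1 hz)
  have hden : ∀ z ∈ disc, 1 - conj b * mapExt γ.1 z ≠ 0 := by
    intro z hz
    rw [sub_eq_add_neg]
    refine one_add_ne_zero_of_norm_lt ?_
    rw [norm_neg, norm_mul, norm_conj]
    nlinarith [norm_nonneg b, norm_nonneg (mapExt γ.1 z), hmaps z hz]
  have hd : ∀ z : 𝔻, HasDerivAt g ((isomDeriv γ z * (1 - conj b * mapExt γ.1 z)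
      - (mapExt γ.1 z - b) * (-(conj b * isomDeriv γ z))) / (1 - conj b * mapExt γ.1 z) ^ 2) z := by
    intro z
    exact ((hasDerivAt_mapExt γ z).sub_const b).div
      (((hasDerivAt_mapExt γ z).const_mul (conj b)).const_sub 1) (hden z (coe_mem_disc z))
  have hm0 : mapExt γ.1 0 = b := by
    have h := mapExt_coe γ.1 0
    rw [UnitDisc.coe_zero] at h
    exact h
  have hg0 : g 0 = 0 := by simp [hg, hm0]
  have hbb : conj b * b = ((‖b‖ ^ 2 : ℝ) : ℂ) := by
    rw [mul_comm, mul_conj, normSq_eq_norm_sq]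
  have hbpos : 0 < 1 - ‖b‖ ^ 2 := one_sub_norm_sq_pos (γ • (0 : 𝔻))
  have hg1 : ‖deriv g 0‖ = 1 := by
    have h := (hd 0).deriv
    simp only [UnitDisc.coe_zero, hm0, sub_self, zero_mul, sub_zero, hbb] at h
    rw [h, norm_div, norm_mul, norm_pow, norm_isomDeriv, ← hb]
    rw [← ofReal_one, ← ofReal_sub, norm_real, Real.norm_of_nonneg hbpos.le]
    simp
    field_simp
  have haff := affine_of_mapsTo_ball_of_norm_dslope_eq_div (f := g) (c := 0) (z₀ := 0)
    (R₁ := 1) (R₂ := 1)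
    (fun z hz => by
      obtain ⟨w, rfl⟩ : ∃ w : 𝔻, (w : ℂ) = z := ⟨UnitDisc.mk z (mem_disc.1 hz), rfl⟩
      exact (hd w).differentiableAt.differentiableWithinAt)
    (fun z hz => by
      rw [hg0, mem_closedBall_zero_iff, hg, norm_div]
      exact div_le_one_of_le₀ (norm_sub_lt_norm_one_sub hb1 (hmaps z hz)).le (norm_nonneg _))
    (by simp) (by simp [hg1])
  refine ⟨deriv g 0, b, hg1, hb1, fun z => ?_⟩
  have h := haff (coe_mem_disc z)
  simp only [hg0, dslope_same, zero_add, sub_zero, smul_eq_mul] at h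
  have hz : mapExt γ.1 z = ((γ • z : 𝔻) : ℂ) := mapExt_coe γ.1 z
  have h0 := hden z (coe_mem_disc z)
  simp only [hg] at h
  rw [div_eq_iff h0, hz] at h
  have hne : 1 + conj b * deriv g 0 * z ≠ 0 := by
    refine one_add_ne_zero_of_norm_lt ?_
    rw [norm_mul, norm_mul, hg1, norm_conj]
    nlinarith [norm_nonneg b, norm_nonneg (z : ℂ), z.norm_lt_one]
  rw [eq_div_iff hne]
  linear_combination h

/-! ### Boundary values of holomorphic vector fields -/

/-- Lebesgue measure on the parameter interval of the circle. -/
noncomputable abbrev angleMeasure : Measure ℝ := volume.restrict (Ioc 0 (2 * Real.pi))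

/-- `L²`-convergence of the restrictions to circles, for functions given on a neighbourhood of
the disc. -/
def HasL2Limit (X : ℂ → ℂ) (Y : Circle → ℂ) : Prop :=
  MemLp (fun θ : ℝ => Y (Circle.exp θ)) 2 angleMeasure ∧
  Tendsto (fun r : ℝ => eLpNorm (fun θ : ℝ => X (r * Circle.exp θ) - Y (Circle.exp θ)) 2
    angleMeasure) (𝓝[<] 1) (𝓝 0)

theorem hasL2Extension_iff {χ : 𝔻 → ℂ} {Y : Circle → ℂ} :
    HasL2Extension χ Y ↔ HasL2Limit (discExt χ) Y := Iff.rfl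

theorem eventually_radius : ∀ᶠ r : ℝ in 𝓝[<] 1, 0 < r ∧ r < 1 :=
  Ioo_mem_nhdsLT zero_lt_one

theorem norm_mul_circle {r : ℝ} (hr : 0 < r) (w : Circle) : ‖(r : ℂ) * w‖ = r := by
  rw [norm_mul, norm_real, Circle.norm_coe, mul_one, Real.norm_of_nonneg hr.le]

theorem mul_circle_mem_disc {r : ℝ} (hr : 0 < r ∧ r < 1) (w : Circle) : (r : ℂ) * w ∈ disc := by
  rw [mem_disc, norm_mul_circle hr.1]
  exact hr.2

theorem continuous_circle_restriction {X : ℂ → ℂ} (hX : ContinuousOn X disc) {r : ℝ}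
    (hr : 0 < r ∧ r < 1) : Continuous fun θ : ℝ => X (r * Circle.exp θ) :=
  hX.comp_continuous (by fun_prop) fun θ => mul_circle_mem_disc hr _

theorem HasL2Limit.congr {X X' : ℂ → ℂ} {Y : Circle → ℂ} (h : HasL2Limit X Y)
    (hX : EqOn X X' disc) : HasL2Limit X' Y := by
  refine ⟨h.1, h.2.congr' ?_⟩
  filter_upwards [eventually_radius] with r hr
  refine eLpNorm_congr_ae (Eventually.of_forall fun θ => ?_)
  simp only [hX (mul_circle_mem_disc hr (Circle.exp θ))]

theorem HasL2Limit.add {X X' : ℂ → ℂ} {Y Y' : Circle → ℂ} (h : HasL2Limit X Y)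
    (h' : HasL2Limit X' Y') (hX : ContinuousOn X disc) (hX' : ContinuousOn X' disc) :
    HasL2Limit (X + X') (Y + Y') := by
  refine ⟨h.1.add h'.1, ?_⟩
  have hsum := h.2.add h'.2
  rw [add_zero] at hsum
  refine tendsto_of_tendsto_of_tendsto_of_le_of_le' tendsto_const_nhds hsum
    (Eventually.of_forall fun _ => zero_le) ?_
  filter_upwards [eventually_radius] with r hr
  refine le_trans (le_of_eq ?_) (eLpNorm_add_le
    ((continuous_circle_restriction hX hr).aestronglyMeasurable.sub h.1.aestronglyMeasurable)
    ((continuous_circle_restriction hX' hr).aestronglyMeasurable.sub h'.1.aestronglyMeasurable)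
    one_le_two)
  congr 1
  funext θ
  simp only [Pi.add_apply]
  ring

theorem HasL2Limit.const_mul {X : ℂ → ℂ} {Y : Circle → ℂ} (h : HasL2Limit X Y) (a : ℂ) :
    HasL2Limit (fun z => a * X z) (fun w => a * Y w) := by
  refine ⟨h.1.const_mul a, ?_⟩
  have hm := ENNReal.Tendsto.const_mul (a := ‖a‖ₑ) h.2 (Or.inr enorm_ne_top)
  rw [mul_zero] at hm
  refine hm.congr fun r => ?_
  rw [← eLpNorm_const_smul]
  congr 1
  funext θ
  simp only [Pi.smul_apply, smul_eq_mul]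
  ring

theorem HasL2Limit.neg {X : ℂ → ℂ} {Y : Circle → ℂ} (h : HasL2Limit X Y) :
    HasL2Limit (-X) (-Y) := by
  have h' := h.const_mul (-1)
  simp only [neg_one_mul] at h'
  exact h'

theorem HasL2Limit.sub {X X' : ℂ → ℂ} {Y Y' : Circle → ℂ} (h : HasL2Limit X Y)
    (h' : HasL2Limit X' Y') (hX : ContinuousOn X disc) (hX' : ContinuousOn X' disc) :
    HasL2Limit (X - X') (Y - Y') := by
  rw [sub_eq_add_neg, sub_eq_add_neg]
  exact h.add h'.neg hX hX'.neg

theorem isTangential_zero : IsTangential 0 :=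
  Eventually.of_forall fun _ => ⟨0, by simp⟩

theorem IsTangential.sub {Y Y' : Circle → ℂ} (h : IsTangential Y) (h' : IsTangential Y') :
    IsTangential (Y - Y') := by
  filter_upwards [h, h'] with θ ⟨a, ha⟩ ⟨b, hb⟩
  refine ⟨a - b, ?_⟩
  rw [Pi.sub_apply, ha, hb]
  push_cast
  ring

/-- The Fourier coefficients of a function on the circle, up to a factor `2 π`. -/
noncomputable def circleCoeff (n : ℤ) (g : ℝ → ℂ) : ℂ :=
  ∫ θ : ℝ, g θ * (Circle.exp θ : ℂ) ^ (-n) ∂angleMeasure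

theorem continuous_circle_zpow (n : ℤ) : Continuous fun θ : ℝ => (Circle.exp θ : ℂ) ^ n :=
  Continuous.zpow₀ (by fun_prop) n fun _ => Or.inl (Circle.coe_ne_zero _)

theorem norm_circle_zpow (n : ℤ) (w : Circle) : ‖(w : ℂ) ^ n‖ = 1 := by
  rw [norm_zpow, Circle.norm_coe, one_zpow]

/-- The characters are unimodular and the measure is finite, so `L²` convergence gives `L¹`
convergence of the integrands. -/
theorem HasL2Limit.tendsto_circleCoeff {X : ℂ → ℂ} {Y : Circle → ℂ} (h : HasL2Limit X Y)
    (hX : ContinuousOn X disc) (n : ℤ) :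
    Tendsto (fun r : ℝ => circleCoeff n fun θ => X (r * Circle.exp θ)) (𝓝[<] 1)
      (𝓝 (circleCoeff n fun θ => Y (Circle.exp θ))) := by
  have hz := continuous_circle_zpow (-n)
  have hY : AEStronglyMeasurable (fun θ : ℝ => Y (Circle.exp θ)) angleMeasure :=
    h.1.aestronglyMeasurable
  refine tendsto_integral_of_L1' _ (hY.mul hz.aestronglyMeasurable) ?_ ?_
  · filter_upwards [eventually_radius] with r hr
    exact (((continuous_circle_restriction hX hr).mul hz).continuousOn.integrableOn_Icc).mono_set
      Ioc_subset_Icc_self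
  · have hb := ENNReal.Tendsto.mul_const (b := angleMeasure univ ^ (1 / (1 : ENNReal).toReal -
      1 / (2 : ENNReal).toReal)) h.2 (Or.inr (by
        refine ENNReal.rpow_ne_top_of_nonneg (by norm_num) (measure_ne_top _ _)))
    rw [zero_mul] at hb
    refine tendsto_of_tendsto_of_tendsto_of_le_of_le' tendsto_const_nhds hb
      (Eventually.of_forall fun _ => zero_le) ?_
    filter_upwards [eventually_radius] with r hr
    refine le_trans (eLpNorm_mono fun θ => ?_) (eLpNorm_le_eLpNorm_mul_rpow_measure_univ
      one_le_two ((continuous_circle_restriction hX hr).aestronglyMeasurable.sub hY))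
    change ‖X (r * Circle.exp θ) * (Circle.exp θ : ℂ) ^ (-n) -
      Y (Circle.exp θ) * (Circle.exp θ : ℂ) ^ (-n)‖ ≤ ‖X (r * Circle.exp θ) - Y (Circle.exp θ)‖
    rw [← sub_mul, norm_mul, norm_circle_zpow, mul_one]

theorem circleCoeff_eq_circleIntegral {X : ℂ → ℂ} {r : ℝ} (hr : 0 < r) (n : ℤ) :
    (circleCoeff n fun θ => X (r * Circle.exp θ)) =
      (r : ℂ) ^ n * I⁻¹ * ∮ z in C(0, r), X z * z ^ (-n - 1) := by
  have hr' : (r : ℂ) ≠ 0 := by exact_mod_cast hr.ne'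
  rw [circleIntegral, intervalIntegral.integral_of_le Real.two_pi_pos.le, ← integral_const_mul,
    circleCoeff]
  congr 1
  funext θ
  have hw := Circle.coe_ne_zero (Circle.exp θ)
  have hc : circleMap 0 r θ = r * Circle.exp θ := by simp [circleMap]
  rw [deriv_circleMap, hc, smul_eq_mul, mul_zpow, zpow_sub_one₀ hr', zpow_sub_one₀ hw, zpow_neg,
    zpow_neg]
  have := zpow_ne_zero n hr'
  have := zpow_ne_zero n hw
  field_simp

/-- For `Y = a i w` with `a` real, `conj Y = -w⁻² Y`; conjugating the integral therefore reflects
the index about `1`. -/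
theorem IsTangential.conj_circleCoeff {Y : Circle → ℂ} (h : IsTangential Y) (n : ℤ) :
    conj (circleCoeff n fun θ => Y (Circle.exp θ)) =
      -circleCoeff (2 - n) fun θ => Y (Circle.exp θ) := by
  rw [circleCoeff, circleCoeff, ← integral_conj, ← integral_neg]
  refine integral_congr_ae ?_
  filter_upwards [h] with θ ⟨a, ha⟩
  have hw := Circle.coe_ne_zero (Circle.exp θ)
  rw [ha, map_mul, map_mul, map_mul, map_zpow₀, conj_I, conj_ofReal, ← Circle.coe_inv_eq_conj,
    Circle.coe_inv, inv_zpow', neg_neg, neg_sub, zpow_sub₀ hw]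
  field_simp

/-- A holomorphic function on the disc with tangential `L²`-boundary values is a quadratic
polynomial of the form which characterizes Killing vector fields. -/
theorem eq_quadratic_of_isTangential {X : ℂ → ℂ} (hX : DifferentiableOn ℂ X disc)
    {Y : Circle → ℂ} (hY : HasL2Limit X Y) (ht : IsTangential Y) :
    ∃ b c : ℂ, c.re = 0 ∧ ∀ z ∈ disc, X z = b + c * z - conj b * z ^ 2 := by
  have hps : ∀ r : ℝ, 0 < r → r < 1 →
      HasFPowerSeriesOnBall X (cauchyPowerSeries X 0 r) 0 (ENNReal.ofReal r) := by
    intro r h0 h1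
    lift r to NNReal using h0.le
    rw [ENNReal.ofReal_coe_nnreal]
    refine DifferentiableOn.hasFPowerSeriesOnBall (hX.mono fun z hz => ?_) (by exact_mod_cast h0)
    rw [mem_disc]
    exact (mem_closedBall_zero_iff.1 hz).trans_lt h1
  set p := cauchyPowerSeries X 0 (1 / 2 : ℝ) with hp
  -- The Taylor series does not depend on the radius used to compute it; `1 / 2` is an arbitrary
  -- reference radius.
  have hpr : ∀ r : ℝ, 0 < r → r < 1 → cauchyPowerSeries X 0 r = p := fun r h0 h1 =>
    (hps r h0 h1).hasFPowerSeriesAt.eq_formalMultilinearSeries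
      (hps (1 / 2) (by norm_num) (by norm_num)).hasFPowerSeriesAt
  have hcoef : ∀ n : ℕ, ∀ r : ℝ, 0 < r → r < 1 →
      (circleCoeff n fun θ => X (r * Circle.exp θ)) = (r : ℂ) ^ n * (2 * Real.pi * p.coeff n) := by
    intro n r h0 h1
    rw [circleCoeff_eq_circleIntegral h0]
    have h : p.coeff n = cauchyPowerSeries X 0 r n fun _ => 1 := by rw [hpr r h0 h1]; rfl
    rw [h, cauchyPowerSeries_apply]
    have hint : (∮ z in C(0, r), (1 / (z - 0)) ^ n • (z - 0)⁻¹ • X z) =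
        ∮ z in C(0, r), X z * z ^ (-(n : ℤ) - 1) := by
      refine circleIntegral.integral_congr h0.le fun z hz => ?_
      have hz0 : z ≠ 0 := by
        rintro rfl
        simp at hz
        exact h0.ne hz
      simp only [smul_eq_mul, sub_zero]
      rw [zpow_sub_one₀ hz0, zpow_neg, zpow_natCast, one_div, inv_pow]
      ring
    rw [hint, zpow_natCast, smul_eq_mul]
    have hpi : (Real.pi : ℂ) ≠ 0 := by exact_mod_cast Real.pi_ne_zero
    field_simp [I_ne_zero]
  have hneg : ∀ n : ℕ, ∀ r : ℝ, 0 < r → r < 1 →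
      (circleCoeff (-(n + 1 : ℕ)) fun θ => X (r * Circle.exp θ)) = 0 := by
    intro n r h0 h1
    rw [circleCoeff_eq_circleIntegral h0, circleIntegral_eq_zero_of_differentiable_on_off_countable
      (s := ∅) h0.le countable_empty, mul_zero]
    · have he : -(-((n + 1 : ℕ) : ℤ)) - 1 = (n : ℤ) := by push_cast; ring
      simp only [he, zpow_natCast]
      refine (hX.continuousOn.mono fun z hz => ?_).mul (by fun_prop)
      rw [mem_disc]
      exact (mem_closedBall_zero_iff.1 hz).trans_lt h1
    · have he : -(-((n + 1 : ℕ) : ℤ)) - 1 = (n : ℤ) := by push_cast; ring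
      simp only [he, zpow_natCast]
      intro z hz
      refine DifferentiableAt.mul (hX.differentiableAt (isOpen_disc.mem_nhds ?_)) (by fun_prop)
      rw [mem_disc]
      exact (mem_ball_zero_iff.1 hz.1).trans h1
  set y : ℤ → ℂ := fun n => circleCoeff n fun θ => Y (Circle.exp θ) with hy
  have hy1 : ∀ n : ℕ, y n = 2 * Real.pi * p.coeff n := by
    intro n
    refine tendsto_nhds_unique (hY.tendsto_circleCoeff hX.continuousOn n) ?_
    have hr : Tendsto (fun r : ℝ => (r : ℂ) ^ n * (2 * Real.pi * p.coeff n)) (𝓝[<] 1)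
        (𝓝 (((1 : ℝ) : ℂ) ^ n * (2 * Real.pi * p.coeff n))) :=
      (Continuous.tendsto (by fun_prop) 1).mono_left nhdsWithin_le_nhds
    rw [ofReal_one, one_pow, one_mul] at hr
    refine hr.congr' ?_
    filter_upwards [eventually_radius] with r h
    exact (hcoef n r h.1 h.2).symm
  have hy2 : ∀ n : ℕ, y (-(n + 1 : ℕ)) = 0 := by
    intro n
    refine tendsto_nhds_unique (hY.tendsto_circleCoeff hX.continuousOn _) ?_
    refine tendsto_const_nhds.congr' ?_
    filter_upwards [eventually_radius] with r h
    exact (hneg n r h.1 h.2).symm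
  have hys : ∀ n, conj (y n) = -y (2 - n) := fun n => ht.conj_circleCoeff n
  have hpi : (2 * Real.pi : ℂ) ≠ 0 := by exact_mod_cast Real.two_pi_pos.ne'
  -- The reflection `n ↦ 2 - n` sends `n + 3` to `-(n + 1)`, where the coefficient vanishes by
  -- Cauchy's theorem. The indices `0, 2` are exchanged and `1` is fixed, which gives the remaining
  -- relations.
  have h3 : ∀ n : ℕ, p.coeff (n + 3) = 0 := by
    intro n
    have h := hys (n + 3 : ℕ)
    rw [show (2 - ((n + 3 : ℕ) : ℤ)) = -((n + 1 : ℕ) : ℤ) by push_cast; ring, hy2, neg_zero,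
      map_eq_zero, hy1] at h
    exact (mul_eq_zero.1 h).resolve_left hpi
  have hcpi : conj (2 * Real.pi : ℂ) = 2 * Real.pi := by
    rw [map_mul, conj_ofReal, map_ofNat]
  have h1 : conj (p.coeff 1) = -p.coeff 1 := by
    have h := hys (1 : ℕ)
    rw [show (2 - ((1 : ℕ) : ℤ)) = ((1 : ℕ) : ℤ) by norm_num, hy1, map_mul, hcpi] at h
    exact mul_left_cancel₀ hpi (by linear_combination h)
  have h2 : p.coeff 2 = -conj (p.coeff 0) := by
    have h := hys (0 : ℕ)
    rw [show (2 - ((0 : ℕ) : ℤ)) = ((2 : ℕ) : ℤ) by norm_num, hy1, hy1, map_mul, hcpi] at h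
    exact mul_left_cancel₀ hpi (by linear_combination h)
  refine ⟨p.coeff 0, p.coeff 1, ?_, fun z hz => ?_⟩
  · have h := congrArg re h1
    rw [conj_re, neg_re] at h
    linarith
  · rw [mem_disc] at hz
    obtain ⟨r, hr1, hr2⟩ := exists_between hz
    have hr0 : 0 < r := (norm_nonneg z).trans_lt hr1
    have hs := (hps r hr0 hr2).hasSum (y := z) (by
      rw [Metric.mem_eball, edist_zero_right, ← ofReal_norm]
      exact (ENNReal.ofReal_lt_ofReal_iff hr0).2 hr1)
    rw [hpr r hr0 hr2, zero_add] at hs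
    have hs' : HasSum (fun n => p n fun _ => z) (∑ n ∈ Finset.range 3, p n fun _ => z) := by
      refine hasSum_sum_of_ne_finset_zero fun n hn => ?_
      obtain ⟨m, rfl⟩ : ∃ m, n = m + 3 := ⟨n - 3, by simp at hn; omega⟩
      rw [FormalMultilinearSeries.apply_eq_pow_smul_coeff, h3, smul_zero]
    rw [hs.unique hs', Finset.sum_range_succ, Finset.sum_range_succ, Finset.sum_range_one]
    simp only [FormalMultilinearSeries.apply_eq_pow_smul_coeff, smul_eq_mul, h2]
    ring

/-! ### The Cauchy-Riemann operator -/

/-- `X` is real differentiable at `z` and `∂X/∂x + i ∂X/∂y = d` there. -/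
def HasDbarAt (X : ℂ → ℂ) (d z : ℂ) : Prop :=
  ∃ L : ℂ →L[ℝ] ℂ, HasFDerivAt X L z ∧ L 1 + I * L I = d

namespace HasDbarAt

variable {X Y : ℂ → ℂ} {d e z : ℂ}

theorem add (hX : HasDbarAt X d z) (hY : HasDbarAt Y e z) :
    HasDbarAt (fun p => X p + Y p) (d + e) z := by
  obtain ⟨L, hL, rfl⟩ := hX
  obtain ⟨M, hM, rfl⟩ := hY
  exact ⟨L + M, hL.add hM, by simp only [_root_.add_apply]; ring⟩

theorem sub (hX : HasDbarAt X d z) (hY : HasDbarAt Y e z) :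
    HasDbarAt (fun p => X p - Y p) (d - e) z := by
  obtain ⟨L, hL, rfl⟩ := hX
  obtain ⟨M, hM, rfl⟩ := hY
  exact ⟨L - M, hL.sub hM, by simp only [_root_.sub_apply]; ring⟩

theorem mul (hX : HasDbarAt X d z) (hY : HasDbarAt Y e z) :
    HasDbarAt (fun p => X p * Y p) (X z * e + Y z * d) z := by
  obtain ⟨L, hL, rfl⟩ := hX
  obtain ⟨M, hM, rfl⟩ := hY
  refine ⟨_, hL.mul hM, ?_⟩
  simp only [_root_.add_apply, _root_.smul_apply, smul_eq_mul]
  ring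

theorem of_hasDerivAt (h : HasDerivAt X e z) : HasDbarAt X 0 z := by
  refine ⟨_, h.complexToReal_fderiv, ?_⟩
  simp only [_root_.smul_apply, one_apply_eq_self, smul_eq_mul]
  linear_combination e * I_mul_I

theorem conj_of_hasDerivAt (h : HasDerivAt X e z) :
    HasDbarAt (fun p => conj (X p)) (2 * conj e) z := by
  refine ⟨_, (conjCLE.toContinuousLinearMap.hasFDerivAt (x := X z)).comp z h.complexToReal_fderiv,
    ?_⟩
  simp only [ContinuousLinearMap.comp_apply, _root_.smul_apply, one_apply_eq_self,
    smul_eq_mul, ContinuousLinearEquiv.coe_coe, conjCLE_apply, map_mul, map_one, conj_I]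
  linear_combination -conj e * I_mul_I

theorem congr (h : HasDbarAt X d z) (hz : z ∈ disc) (hXY : EqOn X Y disc) : HasDbarAt Y d z := by
  obtain ⟨L, hL, hd⟩ := h
  exact ⟨L, hL.congr_of_eventuallyEq
    (hXY.symm.eventuallyEq_of_mem (isOpen_disc.mem_nhds hz)), hd⟩

theorem differentiableAt (h : HasDbarAt X 0 z) : DifferentiableAt ℂ X z := by
  obtain ⟨L, hL, hd⟩ := h
  refine differentiableAt_complex_iff_differentiableAt_real.2 ⟨hL.differentiableAt, ?_⟩
  rw [hL.fderiv, smul_eq_mul]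
  linear_combination -I * hd + L I * I_mul_I

theorem unique (hX : HasDbarAt X d z) (hY : HasDbarAt X e z) : d = e := by
  obtain ⟨L, hL, rfl⟩ := hX
  obtain ⟨M, hM, rfl⟩ := hY
  rw [hL.unique hM]

end HasDbarAt

theorem hasDbarAt_self {X : ℂ → ℂ} {z : ℂ} (h : DifferentiableAt ℝ X z) :
    HasDbarAt X (fderiv ℝ X z 1 + I * fderiv ℝ X z I) z := ⟨_, h.hasFDerivAt, rfl⟩

/-- Differentiating the conformal factor contributes a multiple of the metric, which is pure trace.
In the other two terms the trace-free part sees only the antilinear part of the derivative of `X`,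
which is what `d` records. -/
theorem quadraticPart_lieMetric {X : 𝔻 → ℂ} {d : ℂ} {z : 𝔻} (h : HasDbarAt (discExt X) d z) :
    quadraticPart (lieMetric X z) = 4 / (1 - z * conj (z : ℂ)) ^ 2 * conj d := by
  obtain ⟨L, hL, rfl⟩ := h
  have hz : (1 - z * conj (z : ℂ)) = ((1 - ‖(z : ℂ)‖ ^ 2 : ℝ) : ℂ) := by
    rw [mul_conj, normSq_eq_norm_sq]
    push_cast
    rfl
  simp only [quadraticPart, lieMetric, hL.fderiv, discMetric, Complex.inner, hz]
  have hq : (4 : ℂ) / ((1 - ‖(z : ℂ)‖ ^ 2 : ℝ) : ℂ) ^ 2 =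
      ((4 / (1 - ‖(z : ℂ)‖ ^ 2) ^ 2 : ℝ) : ℂ) := by push_cast; rfl
  rw [hq]
  generalize 4 / (1 - ‖(z : ℂ)‖ ^ 2) ^ 2 = lam
  apply Complex.ext
  · simp
    ring
  · simp
    ring

theorem HasDbarAt.of_quadraticPart {X : 𝔻 → ℂ} (hX : IsSmooth X) {f : ℂ} {z : 𝔻}
    (h : quadraticPart (lieMetric X z) = f) :
    HasDbarAt (discExt X) ((1 - z * conj (z : ℂ)) ^ 2 / 4 * conj f) z := by
  have hd := hasDbarAt_self (differentiableAt_of_contDiffOn hX z)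
  rw [quadraticPart_lieMetric hd] at h
  convert hd
  have hz : (1 - z * conj (z : ℂ)) ≠ 0 := by
    rw [mul_conj, normSq_eq_norm_sq]
    exact_mod_cast (one_sub_norm_sq_pos z).ne'
  have hz' : (1 - conj (z : ℂ) * z) ≠ 0 := by rwa [mul_comm]
  rw [← h]
  simp only [map_mul, map_div₀, map_pow, map_sub, map_one, conj_conj, map_ofNat, map_add, conj_I,
    map_neg,
    neg_neg]
  field_simp

/-! ### Killing fields -/

/-- The restriction to the disc of a function on `ℂ`. -/
def toDisc (X : ℂ → ℂ) : 𝔻 → ℂ := fun z => X z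

theorem discExt_toDisc (X : ℂ → ℂ) : EqOn (discExt (toDisc X)) X disc := by
  intro z hz
  rw [discExt_of_norm_lt _ (mem_disc.1 hz), toDisc, UnitDisc.coe_mk]

theorem toDisc_congr {X X' : ℂ → ℂ} (h : EqOn X X' disc) : toDisc X = toDisc X' := by
  funext z
  exact h (coe_mem_disc z)

theorem isSmooth_toDisc {X : ℂ → ℂ} (h : ContDiffOn ℝ ∞ X disc) : IsSmooth (toDisc X) :=
  h.congr (discExt_toDisc X)

theorem fderiv_discMetric (z v w : ℂ) (hz : z ∈ disc) (u : ℂ) :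
    fderiv ℝ (fun p => discMetric p v w) z u =
      16 * inner ℝ z u / (1 - ‖z‖ ^ 2) ^ 3 * inner ℝ v w := by
  have hz' : (1 - ‖z‖ ^ 2) ≠ 0 := by
    rw [mem_disc] at hz
    nlinarith [norm_nonneg z]
  have h1 : HasFDerivAt (fun p : ℂ => ‖p‖ ^ 2) (2 • (innerSL ℝ z)) z :=
    (hasStrictFDerivAt_norm_sq z).hasFDerivAt
  have h2 : HasFDerivAt (fun p : ℂ => discMetric p v w) _ z :=
    (((hasDerivAt_inv (pow_ne_zero 2 hz')).comp_hasFDerivAt z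
      ((h1.const_sub 1).pow 2)).const_mul 4).mul_const (inner ℝ v w)
  rw [h2.fderiv]
  simp
  field_simp
  ring

/-- These are the infinitesimal Möbius transformations of the disc. The field is holomorphic, so
only the trace of the Lie derivative needs to cancel, and it does because `c` is imaginary and the
`z²` coefficient is `-b̄`. -/
theorem toDisc_quadratic_mem_killing {b c : ℂ} (hc : c.re = 0) :
    toDisc (fun z => b + c * z - conj b * z ^ 2) ∈ killing := by
  refine ⟨isSmooth_toDisc (ContDiff.contDiffOn ?_), fun z v w => ?_⟩
  · have h : ContDiff ℂ ∞ fun z : ℂ => b + c * z - conj b * z ^ 2 := by fun_prop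
    exact h.restrict_scalars ℝ
  · have hd : HasDerivAt (fun z => b + c * z - conj b * z ^ 2) (c - conj b * (2 * z)) (z : ℂ) := by
      have := (((hasDerivAt_id (z : ℂ)).const_mul c).const_add b).sub
        (((hasDerivAt_id (z : ℂ)).pow 2).const_mul (conj b))
      exact this.congr_deriv (by simp)
    have hd' := hd.complexToReal_fderiv.congr_of_eventuallyEq
      ((discExt_toDisc _).eventuallyEq_of_mem (disc_mem_nhds z))
    rw [lieMetric, hd'.fderiv, fderiv_discMetric _ _ _ (coe_mem_disc z)]
    have hz := (one_sub_norm_sq_pos z).ne'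
    simp only [discMetric, toDisc, Complex.inner, _root_.smul_apply, one_apply_eq_self,
      smul_eq_mul, mul_re, mul_im, conj_re, conj_im, add_re, add_im, sub_re, sub_im,
      pow_two (z : ℂ), re_ofNat, im_ofNat]
    field_simp
    rw [← normSq_eq_norm_sq, normSq_apply]
    simp only [hc]
    ring

theorem hasDbarAt_of_mem_killing {X : 𝔻 → ℂ} (hX : X ∈ killing) (z : 𝔻) :
    HasDbarAt (discExt X) 0 z := by
  have h := HasDbarAt.of_quadraticPart (f := 0) (z := z) hX.1
    (by simp [quadraticPart, hX.2])
  simpa using h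

/-! ### Pulling back vector fields -/

theorem pullback_mul (γ δ : IsomPlus) (X : 𝔻 → ℂ) :
    pullback (γ * δ) X = pullback δ (pullback γ X) := by
  funext z
  simp only [pullback, isomDeriv_mul, mul_smul, mul_inv]
  ring

theorem pullback_sub (γ : IsomPlus) (X Y : 𝔻 → ℂ) :
    pullback γ (X - Y) = pullback γ X - pullback γ Y := by
  funext z
  simp [pullback, sub_mul]

theorem coboundary_mul (X : 𝔻 → ℂ) (γ δ : IsomPlus) :
    coboundary X (γ * δ) = pullback δ (coboundary X γ) + coboundary X δ := by
  simp only [coboundary, pullback_mul, pullback_sub]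
  abel

theorem coboundary_sub (X Y : 𝔻 → ℂ) (γ : IsomPlus) :
    coboundary (X - Y) γ = coboundary X γ - coboundary Y γ := by
  simp only [coboundary, pullback_sub]
  abel

/-! ### Third primitives and the associated vector fields -/

/-- `F` is holomorphic on the disc with third derivative `f`. -/
def IsThirdPrimitive (F f : ℂ → ℂ) : Prop :=
  DifferentiableOn ℂ F disc ∧ EqOn (deriv (deriv (deriv F))) f disc

theorem hasDerivAt_of_disc {F : ℂ → ℂ} (hF : DifferentiableOn ℂ F disc) {z : ℂ} (hz : z ∈ disc) :
    HasDerivAt F (deriv F z) z := (hF.differentiableAt (isOpen_disc.mem_nhds hz)).hasDerivAt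

theorem differentiableOn_deriv {F : ℂ → ℂ} (hF : DifferentiableOn ℂ F disc) :
    DifferentiableOn ℂ (deriv F) disc := hF.deriv isOpen_disc

theorem eqOn_deriv {F G : ℂ → ℂ} (h : EqOn F G disc) : EqOn (deriv F) (deriv G) disc :=
  fun _ hz => (h.eventuallyEq_of_mem (isOpen_disc.mem_nhds hz)).deriv_eq

theorem eqOn_deriv_of_hasDerivAt {F G : ℂ → ℂ} (h : ∀ z ∈ disc, HasDerivAt F (G z) z) :
    EqOn (deriv F) G disc := fun z hz => (h z hz).deriv

theorem isThirdPrimitive_of_hasDerivAt {F F₁ F₂ f : ℂ → ℂ}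
    (h : ∀ z ∈ disc, HasDerivAt F (F₁ z) z) (h₁ : ∀ z ∈ disc, HasDerivAt F₁ (F₂ z) z)
    (h₂ : ∀ z ∈ disc, HasDerivAt F₂ (f z) z) : IsThirdPrimitive F f :=
  ⟨fun z hz => (h z hz).differentiableAt.differentiableWithinAt,
    (eqOn_deriv (eqOn_deriv (eqOn_deriv_of_hasDerivAt h))).trans
      ((eqOn_deriv (eqOn_deriv_of_hasDerivAt h₁)).trans (eqOn_deriv_of_hasDerivAt h₂))⟩

theorem exists_isThirdPrimitive {f : ℂ → ℂ} (hf : DifferentiableOn ℂ f disc) :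
    ∃ F, IsThirdPrimitive F f := by
  obtain ⟨F₂, h₂⟩ := hf.isExactOn_ball
  obtain ⟨F₁, h₁⟩ := DifferentiableOn.isExactOn_ball (f := F₂) (c := 0) (r := 1) fun z hz =>
    (h₂ z hz).differentiableAt.differentiableWithinAt
  obtain ⟨F, h⟩ := DifferentiableOn.isExactOn_ball (f := F₁) (c := 0) (r := 1) fun z hz =>
    (h₁ z hz).differentiableAt.differentiableWithinAt
  exact ⟨F, isThirdPrimitive_of_hasDerivAt h h₁ h₂⟩

theorem IsThirdPrimitive.sub {F G f g : ℂ → ℂ} (hF : IsThirdPrimitive F f)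
    (hG : IsThirdPrimitive G g) : IsThirdPrimitive (F - G) (f - g) := by
  have hs : ∀ {F G : ℂ → ℂ}, DifferentiableOn ℂ F disc → DifferentiableOn ℂ G disc →
      ∀ z ∈ disc, HasDerivAt (F - G) ((deriv F - deriv G) z) z := fun hF hG z hz =>
    (hasDerivAt_of_disc hF hz).sub (hasDerivAt_of_disc hG hz)
  have hF1 := differentiableOn_deriv hF.1
  have hG1 := differentiableOn_deriv hG.1
  refine isThirdPrimitive_of_hasDerivAt (hs hF.1 hG.1) (hs hF1 hG1) fun z hz => ?_
  rw [Pi.sub_apply, ← hF.2 hz, ← hG.2 hz]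
  exact hs (differentiableOn_deriv hF1) (differentiableOn_deriv hG1) z hz

/-- On the disc, a function with vanishing derivative is constant. -/
theorem exists_eq_const_of_deriv {F : ℂ → ℂ} (h : ∀ z ∈ disc, HasDerivAt F 0 z) :
    ∃ a, ∀ z ∈ disc, F z = a := by
  refine ⟨F 0, fun z hz => ?_⟩
  exact isOpen_disc.is_const_of_deriv_eq_zero (convex_ball 0 1).isPreconnected
    (fun w hw => (h w hw).differentiableAt.differentiableWithinAt) (fun w hw => (h w hw).deriv)
    hz (by simp [disc])

theorem IsThirdPrimitive.eq_quadratic {F : ℂ → ℂ} (hF : IsThirdPrimitive F 0) :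
    ∃ a b c : ℂ, EqOn F (fun z => a + b * z + c * z ^ 2) disc := by
  have hF1 := differentiableOn_deriv hF.1
  obtain ⟨c, hc⟩ := exists_eq_const_of_deriv fun z hz =>
    (hasDerivAt_of_disc (differentiableOn_deriv hF1) hz).congr_deriv (hF.2 hz)
  obtain ⟨b, hb⟩ := exists_eq_const_of_deriv (F := fun z => deriv F z - c * z) fun z hz =>
    ((hasDerivAt_of_disc hF1 hz).sub ((hasDerivAt_id z).const_mul c)).congr_deriv
      (by rw [hc z hz]; ring)
  obtain ⟨a, ha⟩ := exists_eq_const_of_deriv (F := fun z => F z - (b * z + c / 2 * z ^ 2))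
    fun z hz => ((hasDerivAt_of_disc hF.1 hz).sub (((hasDerivAt_id z).const_mul b).add
      (((hasDerivAt_id z).pow 2).const_mul (c / 2)))).congr_deriv
      (by have := hb z hz; simp; linear_combination this)
  exact ⟨a, b, c / 2, fun z hz => by have := ha z hz; simp only at this ⊢; linear_combination this⟩

theorem isThirdPrimitive_quadratic (a b c : ℂ) :
    IsThirdPrimitive (fun z => a + b * z + c * z ^ 2) 0 := by
  refine isThirdPrimitive_of_hasDerivAt (F₁ := fun z => b + 2 * c * z) (F₂ := fun _ => 2 * c)
    (fun z _ => ?_) (fun z _ => ?_) (fun z _ => hasDerivAt_const z _)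
  · exact ((((hasDerivAt_id z).const_mul b).const_add a).add
      (((hasDerivAt_id z).pow 2).const_mul c)).congr_deriv (by simp; ring)
  · exact (((hasDerivAt_id z).const_mul (2 * c)).const_add b).congr_deriv (by simp)

/-- The vector field `χ` with `∂χ/∂z̄ = (1 - |z|²)² \bar f / 8` attached to a third primitive of
`f`. -/
noncomputable def eichlerField (F : ℂ → ℂ) (z : ℂ) : ℂ :=
  1 / 8 * ((1 - z * conj z) ^ 2 * conj (deriv (deriv F) z)
    + 2 * z * (1 - z * conj z) * conj (deriv F z) + 2 * z ^ 2 * conj (F z) - 2 * F z)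

theorem eichlerField_congr {F G : ℂ → ℂ} (h : EqOn F G disc) :
    EqOn (eichlerField F) (eichlerField G) disc := fun z hz => by
  simp only [eichlerField, h hz, eqOn_deriv h hz, eqOn_deriv (eqOn_deriv h) hz]

theorem eichlerField_sub {F G : ℂ → ℂ} (hF : DifferentiableOn ℂ F disc)
    (hG : DifferentiableOn ℂ G disc) :
    EqOn (eichlerField (F - G)) (eichlerField F - eichlerField G) disc := by
  have hs : ∀ {F G : ℂ → ℂ}, DifferentiableOn ℂ F disc → DifferentiableOn ℂ G disc →
      EqOn (deriv (F - G)) (deriv F - deriv G) disc := fun hF hG =>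
    eqOn_deriv_of_hasDerivAt fun z hz => (hasDerivAt_of_disc hF hz).sub (hasDerivAt_of_disc hG hz)
  have h1 := hs hF hG
  have h2 := (eqOn_deriv h1).trans (hs (differentiableOn_deriv hF) (differentiableOn_deriv hG))
  intro z hz
  simp only [eichlerField, h1 hz, h2 hz, Pi.sub_apply, map_sub]
  ring

/-- The ambiguity in a third primitive, a quadratic polynomial, becomes exactly the ambiguity of a
potential, a Killing field. -/
theorem eichlerField_quadratic (a b c : ℂ) :
    EqOn (eichlerField fun z => a + b * z + c * z ^ 2)
      (fun z => (conj c - a) / 4 + (conj b - b) / 4 * z - conj ((conj c - a) / 4) * z ^ 2)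
      disc := by
  have h1 : EqOn (deriv fun z => a + b * z + c * z ^ 2) (fun z => b + 2 * c * z) disc :=
    eqOn_deriv_of_hasDerivAt fun z _ => ((((hasDerivAt_id z).const_mul b).const_add a).add
      (((hasDerivAt_id z).pow 2).const_mul c)).congr_deriv (by simp; ring)
  have h2 : EqOn (deriv fun z => b + 2 * c * z) (fun _ => 2 * c) disc :=
    eqOn_deriv_of_hasDerivAt fun z _ =>
      (((hasDerivAt_id z).const_mul (2 * c)).const_add b).congr_deriv (by simp)
  intro z hz
  have h3 := ((eqOn_deriv h1).trans h2) hz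
  simp only [eichlerField, h1 hz, h3, map_add, map_mul, map_pow, map_sub, map_div₀, map_ofNat,
    conj_conj]
  ring

theorem toDisc_eichlerField_quadratic_mem_killing (a b c : ℂ) :
    toDisc (eichlerField fun z => a + b * z + c * z ^ 2) ∈ killing := by
  rw [toDisc_congr (eichlerField_quadratic a b c)]
  exact toDisc_quadratic_mem_killing (by simp)

theorem contDiffOn_eichlerField {F : ℂ → ℂ} (hF : DifferentiableOn ℂ F disc) :
    ContDiffOn ℝ ∞ (eichlerField F) disc := by
  have hr : ∀ {G : ℂ → ℂ}, DifferentiableOn ℂ G disc → ContDiffOn ℝ ∞ G disc := fun hG =>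
    (hG.contDiffOn isOpen_disc).restrict_scalars ℝ
  have hc : ∀ {G : ℂ → ℂ}, DifferentiableOn ℂ G disc →
      ContDiffOn ℝ ∞ (fun z => conj (G z)) disc := fun hG =>
    conjCLE.contDiff.comp_contDiffOn (hr hG)
  have h0 := hr hF
  have h0' := hc hF
  have h1' := hc (differentiableOn_deriv hF)
  have h2' := hc (differentiableOn_deriv (differentiableOn_deriv hF))
  have hz : ContDiffOn ℝ ∞ (fun z : ℂ => z) disc := contDiffOn_id
  have hz' : ContDiffOn ℝ ∞ (fun z : ℂ => conj z) disc := conjCLE.contDiff.contDiffOn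
  unfold eichlerField
  exact contDiffOn_const.mul ((((((contDiffOn_const.sub (hz.mul hz')).pow 2).mul h2').add
    (((contDiffOn_const.mul hz).mul (contDiffOn_const.sub (hz.mul hz'))).mul h1')).add
    ((contDiffOn_const.mul (hz.pow 2)).mul h0')).sub (contDiffOn_const.mul h0))

/-- The derivative telescopes: the `z̄`-derivative of each weight cancels the term where the next
conjugated factor is differentiated, only the term with `conj F'''` survives, and `-2 F` is
holomorphic. `HasDbarAt` measures `2 ∂/∂z̄`, hence `1 / 4` in place of `1 / 8`. -/
theorem IsThirdPrimitive.hasDbarAt {F f : ℂ → ℂ} (hF : IsThirdPrimitive F f) {z : ℂ}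
    (hz : z ∈ disc) :
    HasDbarAt (eichlerField F) ((1 - z * conj z) ^ 2 / 4 * conj (f z)) z := by
  have hF1 := differentiableOn_deriv hF.1
  have h0 := hasDerivAt_of_disc hF.1 hz
  have h1 := hasDerivAt_of_disc hF1 hz
  have h2 := hasDerivAt_of_disc (differentiableOn_deriv hF1) hz
  have hid := HasDbarAt.of_hasDerivAt (hasDerivAt_id z)
  have hidc := HasDbarAt.conj_of_hasDerivAt (hasDerivAt_id z)
  have hc : ∀ a : ℂ, HasDbarAt (fun _ => a) 0 z := fun a =>
    HasDbarAt.of_hasDerivAt (hasDerivAt_const z a)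
  have hs := (hc 1).sub (hid.mul hidc)
  have hd := (hc (1 / 8)).mul ((((hs.mul hs).mul (HasDbarAt.conj_of_hasDerivAt h2)).add
    ((((hc 2).mul hid).mul hs).mul (HasDbarAt.conj_of_hasDerivAt h1))).add
    (((hc 2).mul (hid.mul hid)).mul (HasDbarAt.conj_of_hasDerivAt h0)) |>.sub
    ((hc 2).mul (HasDbarAt.of_hasDerivAt h0)))
  convert hd using 1
  · funext p
    simp only [eichlerField, id]
    ring
  · simp only [id, hF.2 hz, map_one]
    ring

/-! ### Growth estimates and boundary values -/

theorem hasDerivAt_one_sub_rpow {C p : ℝ} (hp : p ≠ 0) {t : ℝ} (ht : t < 1) :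
    HasDerivAt (fun t : ℝ => C / p * (1 - t) ^ (-p)) (C * (1 - t) ^ (-p - 1)) t := by
  have h := (((hasDerivAt_id t).const_sub 1).rpow_const (p := -p)
    (Or.inl (by simp only [id]; linarith))).const_mul (C / p)
  refine h.congr_deriv ?_
  simp only [id]
  field_simp

/-- The bound on `g'` is integrated along a radius by comparison with its explicit primitive. Both
signs of `p` matter: `p > 0` gives growth estimates, `p = -1/2` convergence at the boundary. -/
theorem norm_radial_sub_le {g : ℂ → ℂ} (hg : DifferentiableOn ℂ g disc) {C p : ℝ} (hp : p ≠ 0)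
    (hb : ∀ z ∈ disc, ‖deriv g z‖ ≤ C * (1 - ‖z‖) ^ (-p - 1)) {w : ℂ} (hw : ‖w‖ = 1) {r s : ℝ}
    (hr : 0 ≤ r) (hrs : r ≤ s) (hs : s < 1) :
    ‖g (s * w) - g (r * w)‖ ≤ C / p * (1 - s) ^ (-p) - C / p * (1 - r) ^ (-p) := by
  have hnorm : ∀ t ∈ Icc r s, ‖(t : ℂ) * w‖ = t := fun t ht => by
    rw [norm_mul, hw, mul_one, norm_real, Real.norm_of_nonneg (hr.trans ht.1)]
  have hmem : ∀ t ∈ Icc r s, (t : ℂ) * w ∈ disc := fun t ht => by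
    rw [mem_disc, hnorm t ht]
    exact ht.2.trans_lt hs
  have hd : ∀ t ∈ Icc r s, HasDerivAt (fun t : ℝ => g (t * w) - g (r * w))
      (deriv g (t * w) * w) t := fun t ht => by
    have h1 : HasDerivAt (fun t : ℝ => (t : ℂ) * w) w t := by
      simpa using (ofRealCLM.hasDerivAt (x := t)).mul_const w
    exact ((hasDerivAt_of_disc hg (hmem t ht)).comp t h1).sub_const _
  have hB : ∀ t ∈ Icc r s, HasDerivAt
      (fun t : ℝ => C / p * (1 - t) ^ (-p) - C / p * (1 - r) ^ (-p))
      (C * (1 - t) ^ (-p - 1)) t := fun t ht =>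
    (hasDerivAt_one_sub_rpow hp (ht.2.trans_lt hs)).sub_const _
  refine image_norm_le_of_norm_deriv_right_le_deriv_boundary'
    (fun t ht => (hd t ht).continuousAt.continuousWithinAt)
    (fun t ht => (hd t (Ico_subset_Icc_self ht)).hasDerivWithinAt) (by simp)
    (fun t ht => (hB t ht).continuousAt.continuousWithinAt)
    (fun t ht => (hB t (Ico_subset_Icc_self ht)).hasDerivWithinAt) (fun t ht => ?_)
    (right_mem_Icc.2 hrs)
  rw [norm_mul, hw, mul_one]
  have h := hb _ (hmem t (Ico_subset_Icc_self ht))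
  rwa [hnorm t (Ico_subset_Icc_self ht)] at h

theorem exists_eq_mul_of_disc (z : ℂ) : ∃ w : ℂ, ‖w‖ = 1 ∧ z = ‖z‖ * w := by
  rcases eq_or_ne z 0 with rfl | hz
  · exact ⟨1, by simp, by simp⟩
  · have h : (‖z‖ : ℂ) ≠ 0 := by exact_mod_cast (norm_pos_iff.2 hz).ne'
    exact ⟨z / ‖z‖, by simp [norm_pos_iff.2 hz |>.ne'], by field_simp⟩

theorem exists_norm_le_of_norm_deriv_le {g : ℂ → ℂ} (hg : DifferentiableOn ℂ g disc) {C p : ℝ}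
    (hp : 0 < p) (hC : 0 ≤ C) (hb : ∀ z ∈ disc, ‖deriv g z‖ ≤ C * (1 - ‖z‖) ^ (-p - 1)) :
    ∃ C' : ℝ, 0 ≤ C' ∧ ∀ z ∈ disc, ‖g z‖ ≤ C' * (1 - ‖z‖) ^ (-p) := by
  -- The term `‖g 0‖` is absorbed because `(1 - ‖z‖) ^ (-p) ≥ 1`.
  refine ⟨‖g 0‖ + C / p, by positivity, fun z hz => ?_⟩
  obtain ⟨w, hw, hzw⟩ := exists_eq_mul_of_disc z
  rw [mem_disc] at hz
  have h := norm_radial_sub_le hg hp.ne' hb hw le_rfl (norm_nonneg z) hz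
  rw [← hzw] at h
  simp only [ofReal_zero, zero_mul, sub_zero, Real.one_rpow] at h
  have h1 : 1 ≤ (1 - ‖z‖) ^ (-p) :=
    Real.one_le_rpow_of_pos_of_le_one_of_nonpos (by linarith) (by linarith [norm_nonneg z])
      (by linarith)
  have h2 := norm_le_norm_add_norm_sub' (g z) (g 0)
  have h3 : 0 ≤ C / p := by positivity
  nlinarith [norm_nonneg (g 0)]

/-- `X (r w)` converges to `Y w` at the rate `√(1 - r)`, uniformly in `w`. -/
def HasHoelderLimit (X : ℂ → ℂ) (Y : Circle → ℂ) : Prop :=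
  ∃ K : ℝ, ∀ r : ℝ, 0 ≤ r → r < 1 → ∀ w : Circle, ‖X (r * w) - Y w‖ ≤ K * √(1 - r)

theorem tendsto_sqrt_one_sub (K : ℝ) : Tendsto (fun r : ℝ => K * √(1 - r)) (𝓝[<] 1) (𝓝 0) := by
  have h : Tendsto (fun r : ℝ => K * √(1 - r)) (𝓝 1) (𝓝 (K * √(1 - 1))) :=
    Continuous.tendsto (by fun_prop) 1
  rw [sub_self, Real.sqrt_zero, mul_zero] at h
  exact h.mono_left nhdsWithin_le_nhds

theorem HasHoelderLimit.hasL2Limit {X : ℂ → ℂ} {Y : Circle → ℂ} (h : HasHoelderLimit X Y)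
    (hX : ContinuousOn X disc) : HasL2Limit X Y := by
  obtain ⟨K, hK⟩ := h
  -- A uniform limit of continuous functions; continuity supplies the measurability of `Y`.
  have hcont : Continuous fun θ : ℝ => Y (Circle.exp θ) := by
    refine TendstoUniformly.continuous (p := 𝓝[<] (1 : ℝ))
      (F := fun (r : ℝ) (θ : ℝ) => X (r * Circle.exp θ)) ?_ ?_
    · rw [Metric.tendstoUniformly_iff]
      intro ε hε
      filter_upwards [eventually_radius, (tendsto_sqrt_one_sub K).eventually_lt_const hε]
        with r hr hr' θ
      rw [dist_comm, dist_eq_norm]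
      exact (hK r hr.1.le hr.2 _).trans_lt hr'
    · refine Eventually.frequently ?_
      filter_upwards [eventually_radius] with r hr
      exact continuous_circle_restriction hX hr
  have hbound : ∀ θ : ℝ, ‖Y (Circle.exp θ)‖ ≤ ‖X 0‖ + K := fun θ => by
    have h0 := hK 0 le_rfl one_pos (Circle.exp θ)
    simp only [ofReal_zero, zero_mul, sub_zero, Real.sqrt_one, mul_one] at h0
    have := norm_le_norm_add_norm_sub (X 0) (Y (Circle.exp θ))
    linarith
  refine ⟨MemLp.of_bound hcont.aestronglyMeasurable _ (Eventually.of_forall hbound), ?_⟩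
  have hlim := ENNReal.Tendsto.const_mul (a := angleMeasure univ ^ (2 : ENNReal).toReal⁻¹)
    (ENNReal.tendsto_ofReal (tendsto_sqrt_one_sub K))
    (Or.inr (ENNReal.rpow_ne_top_of_nonneg (by norm_num) (measure_ne_top _ _)))
  rw [ENNReal.ofReal_zero, mul_zero] at hlim
  refine tendsto_of_tendsto_of_tendsto_of_le_of_le' tendsto_const_nhds hlim
    (Eventually.of_forall fun _ => zero_le) ?_
  filter_upwards [eventually_radius] with r hr
  exact eLpNorm_le_of_ae_bound (Eventually.of_forall fun θ => hK r hr.1.le hr.2 _)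

/-- The derivative bound is integrable up to the boundary, so radial values are Cauchy, with a
modulus `2 C √(1 - r)` that is uniform in the direction. -/
theorem exists_hasHoelderLimit {g : ℂ → ℂ} (hg : DifferentiableOn ℂ g disc) {C : ℝ} (hC : 0 ≤ C)
    (hb : ∀ z ∈ disc, ‖deriv g z‖ ≤ C * (1 - ‖z‖) ^ (-(1 / 2 : ℝ))) :
    ∃ Y : Circle → ℂ, HasHoelderLimit g Y := by
  have hdist : ∀ (w : Circle) (r s : ℝ), 0 ≤ r → r ≤ s → s < 1 →
      ‖g (s * w) - g (r * w)‖ ≤ 2 * C * √(1 - r) := by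
    intro w r s hr hrs hs
    have h := norm_radial_sub_le hg (C := C) (p := -(1 / 2)) (by norm_num)
      (fun z hz => (hb z hz).trans_eq (by norm_num)) (Circle.norm_coe w) hr hrs hs
    rw [neg_neg, ← Real.sqrt_eq_rpow, ← Real.sqrt_eq_rpow] at h
    have : 0 ≤ C * √(1 - s) := by positivity
    linarith
  have hlim : ∀ w : Circle, ∃ y : ℂ, Tendsto (fun r : ℝ => g (r * w)) (𝓝[<] 1) (𝓝 y) := by
    intro w
    refine cauchy_map_iff_exists_tendsto.1 (Metric.cauchy_iff.2 ⟨inferInstance, fun ε hε => ?_⟩)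
    obtain ⟨δ, hδ, hδ'⟩ := (eventually_radius.and
      ((tendsto_sqrt_one_sub (2 * C)).eventually_lt_const hε)).exists
    refine ⟨(fun r : ℝ => g (r * w)) '' Ioo δ 1, image_mem_map (Ioo_mem_nhdsLT hδ.2), ?_⟩
    have hle : ∀ r s : ℝ, δ < r → r ≤ s → s < 1 → ‖g (s * w) - g (r * w)‖ < ε := by
      intro r s hr hrs hs
      refine (hdist w r s (hδ.1.trans hr).le hrs hs).trans_lt (lt_of_le_of_lt ?_ hδ')
      have : √(1 - r) ≤ √(1 - δ) := Real.sqrt_le_sqrt (by linarith)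
      gcongr
    rintro _ ⟨r, hr, rfl⟩ _ ⟨s, hs, rfl⟩
    rcases le_total r s with hrs | hrs
    · rw [dist_comm, dist_eq_norm]
      exact hle r s hr.1 hrs hs.2
    · rw [dist_eq_norm]
      exact hle s r hs.1 hrs hr.2
  choose Y hY using hlim
  refine ⟨Y, 2 * C, fun r hr hr1 w => ?_⟩
  rw [norm_sub_rev]
  refine le_of_tendsto ((hY w).sub_const (g (r * w))).norm ?_
  filter_upwards [Ioo_mem_nhdsLT hr1] with s hs
  exact hdist w r s hr hs.1.le hs.2

theorem HasHoelderLimit.exists_bound {X : ℂ → ℂ} {Y : Circle → ℂ} (h : HasHoelderLimit X Y) :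
    ∃ M, ∀ w, ‖Y w‖ ≤ M := by
  obtain ⟨K, hK⟩ := h
  refine ⟨‖X 0‖ + K, fun w => ?_⟩
  have h0 := hK 0 le_rfl one_pos w
  simp only [ofReal_zero, zero_mul, sub_zero, Real.sqrt_one, mul_one] at h0
  have := norm_le_norm_add_norm_sub (X 0) (Y w)
  linarith

/-- Third primitives of a quadratic differential which is bounded in the hyperbolic metric extend
to the boundary circle, and so do the associated vector fields. -/
theorem IsThirdPrimitive.exists_hasHoelderLimit {F f : ℂ → ℂ} (hF : IsThirdPrimitive F f) {C : ℝ}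
    (hb : ∀ z ∈ disc, ‖f z‖ * (1 - ‖z‖ ^ 2) ^ 2 ≤ C) :
    ∃ Y : Circle → ℂ, HasHoelderLimit F Y ∧
      HasHoelderLimit (eichlerField F) fun w => 1 / 4 * ((w : ℂ) ^ 2 * conj (Y w) - Y w) := by
  have hC : 0 ≤ C := le_trans (by positivity) (hb 0 (by simp [disc]))
  have hF1 := differentiableOn_deriv hF.1
  have hF2 := differentiableOn_deriv hF1
  -- The exponent `-2` for `f` is deliberately weakened to `-5/2`. Sharp exponents would make `F''`
  -- of order `-1` and `F'` logarithmic, which the power estimate excludes; the loss leaves orders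
  -- `-3/2` and `-1/2`, still enough for a limit of `F`.
  obtain ⟨C₂, hC₂, hb₂⟩ := exists_norm_le_of_norm_deriv_le hF2 (C := C) (p := 3 / 2)
    (by norm_num) hC (fun z hz => by
      rw [hF.2 hz]
      have hz' := mem_disc.1 hz
      have hn := norm_nonneg z
      have h1 : ‖f z‖ ≤ C * (1 - ‖z‖) ^ (-2 : ℝ) := by
        rw [Real.rpow_neg (by linarith), ← div_eq_mul_inv, le_div_iff₀ (by
          exact Real.rpow_pos_of_pos (by linarith) _), Real.rpow_ofNat]
        refine le_trans ?_ (hb z hz)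
        have : 1 - ‖z‖ ≤ 1 - ‖z‖ ^ 2 := by nlinarith
        have : 0 ≤ 1 - ‖z‖ := by linarith
        gcongr
      refine h1.trans ?_
      gcongr 1
      exact Real.rpow_le_rpow_of_exponent_ge (by linarith) (by linarith) (by norm_num))
  obtain ⟨C₁, hC₁, hb₁⟩ := exists_norm_le_of_norm_deriv_le hF1 (C := C₂) (p := 1 / 2)
    (by norm_num) hC₂ (fun z hz => (hb₂ z hz).trans_eq (by norm_num))
  obtain ⟨Y, hY⟩ := HarmonicDisc.exists_hasHoelderLimit hF.1 hC₁ hb₁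
  obtain ⟨M, hM⟩ := hY.exists_bound
  refine ⟨Y, hY, ?_⟩
  obtain ⟨K, hK⟩ := hY
  -- One summand for each of the `F''`, `F'`, `conj F` and `F` terms of the field. The part `4 * M`
  -- pays for replacing `r²` by `1` in front of `conj Y`.
  refine ⟨1 / 8 * (4 * C₂ + 4 * C₁ + (2 * K + 4 * M) + 2 * K), fun r hr hr1 w => ?_⟩
  set e := √(1 - r) with he
  have he0 : 0 < e := Real.sqrt_pos.2 (by linarith)
  have hee : e ^ 2 = 1 - r := Real.sq_sqrt (by linarith)
  have he1 : e ≤ 1 := by nlinarith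
  have hz : (r : ℂ) * w ∈ disc := by
    rw [mem_disc, norm_mul, Circle.norm_coe, norm_real, Real.norm_of_nonneg hr, mul_one]
    exact hr1
  have hn : ‖(r : ℂ) * w‖ = r := by
    rw [norm_mul, Circle.norm_coe, norm_real, Real.norm_of_nonneg hr, mul_one]
  have hw : (w : ℂ) * conj (w : ℂ) = 1 := by
    rw [mul_conj, normSq_eq_norm_sq, Circle.norm_coe]
    simp
  have hzz : 1 - (r : ℂ) * w * conj ((r : ℂ) * w) = ((1 - r ^ 2 : ℝ) : ℂ) := by
    rw [map_mul, conj_ofReal]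
    push_cast
    linear_combination -(r : ℂ) ^ 2 * hw
  have hr2 : 0 ≤ 1 - r ^ 2 := by nlinarith
  have hr3 : 1 - r ^ 2 ≤ 2 * e ^ 2 := by nlinarith
  have h2 : ‖deriv (deriv F) (r * w)‖ * e ^ 3 ≤ C₂ := by
    have h := hb₂ _ hz
    rw [hn, Real.rpow_neg (by linarith), ← div_eq_mul_inv,
      le_div_iff₀ (Real.rpow_pos_of_pos (by linarith) _)] at h
    rwa [show (1 - r) ^ (3 / 2 : ℝ) = e ^ 3 by
      rw [he, Real.sqrt_eq_rpow, ← Real.rpow_natCast, ← Real.rpow_mul (by linarith)]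
      norm_num] at h
  have h1 : ‖deriv F (r * w)‖ * e ≤ C₁ := by
    have h := hb₁ _ hz
    rwa [hn, Real.rpow_neg (by linarith), ← div_eq_mul_inv,
      le_div_iff₀ (Real.rpow_pos_of_pos (by linarith) _), ← Real.sqrt_eq_rpow] at h
  have h0 := hK r hr hr1 w
  rw [← he] at h0
  have hM0 : 0 ≤ M := (norm_nonneg _).trans (hM w)
  have key : eichlerField F (r * w) - 1 / 4 * ((w : ℂ) ^ 2 * conj (Y w) - Y w) =
      1 / 8 * ((((1 - r ^ 2) ^ 2 : ℝ) : ℂ) * conj (deriv (deriv F) (r * w))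
        + ((2 * r * (1 - r ^ 2) : ℝ) : ℂ) * w * conj (deriv F (r * w))
        + (((2 * r ^ 2 : ℝ) : ℂ) * w ^ 2 * conj (F (r * w) - Y w)
        - ((2 * (1 - r ^ 2) : ℝ) : ℂ) * w ^ 2 * conj (Y w))
        - 2 * (F (r * w) - Y w)) := by
    rw [eichlerField, hzz]
    push_cast
    rw [map_sub]
    ring
  rw [key, norm_mul]
  have h8 : ‖(1 / 8 : ℂ)‖ = 1 / 8 := by norm_num
  rw [h8, mul_assoc (1 / 8 : ℝ)]
  refine mul_le_mul_of_nonneg_left ?_ (by norm_num : (0 : ℝ) ≤ 1 / 8)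
  refine (norm_sub_le _ _).trans (le_trans (add_le_add ((norm_add_le _ _).trans
    (add_le_add (norm_add_le _ _) (norm_sub_le _ _))) le_rfl) ?_)
  simp only [norm_mul, norm_pow, Circle.norm_coe, norm_conj, norm_real, one_pow, mul_one]
  rw [Real.norm_of_nonneg hr2, Real.norm_of_nonneg hr, Real.norm_ofNat, Complex.norm_ofNat]
  have a2 : (1 - r ^ 2) ^ 2 * ‖deriv (deriv F) (r * w)‖ ≤ 4 * C₂ * e := by
    calc (1 - r ^ 2) ^ 2 * ‖deriv (deriv F) (r * w)‖
        ≤ (2 * e ^ 2) ^ 2 * ‖deriv (deriv F) (r * w)‖ := by gcongr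
      _ = 4 * e * (‖deriv (deriv F) (r * w)‖ * e ^ 3) := by ring
      _ ≤ 4 * e * C₂ := by gcongr
      _ = 4 * C₂ * e := by ring
  have a1 : 2 * r * (1 - r ^ 2) * ‖deriv F (r * w)‖ ≤ 4 * C₁ * e := by
    calc 2 * r * (1 - r ^ 2) * ‖deriv F (r * w)‖
        ≤ 2 * 1 * (2 * e ^ 2) * ‖deriv F (r * w)‖ := by gcongr
      _ = 4 * e * (‖deriv F (r * w)‖ * e) := by ring
      _ ≤ 4 * e * C₁ := by gcongr
      _ = 4 * C₁ * e := by ring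
  have a0 : 2 * r ^ 2 * ‖F (r * w) - Y w‖ ≤ 2 * (K * e) := by
    calc 2 * r ^ 2 * ‖F (r * w) - Y w‖ ≤ 2 * 1 * ‖F (r * w) - Y w‖ := by
          gcongr
          nlinarith
      _ ≤ 2 * (K * e) := by linarith
  have b0 : 2 * (1 - r ^ 2) * ‖Y w‖ ≤ 4 * M * e := by
    calc 2 * (1 - r ^ 2) * ‖Y w‖ ≤ 2 * (2 * e ^ 2) * M := by gcongr; exact hM w
      _ = 4 * M * e * e := by ring
      _ ≤ 4 * M * e * 1 := by gcongr
      _ = 4 * M * e := mul_one _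
  linarith

/-- Multiplying `w² Ȳ - Y` by `w̄` gives `conj (w̄ Y) - w̄ Y`, which is `-2i Im (w̄ Y)`. -/
theorem isTangential_eichler (Y : Circle → ℂ) :
    IsTangential fun w => 1 / 4 * ((w : ℂ) ^ 2 * conj (Y w) - Y w) := by
  refine Eventually.of_forall fun θ => ?_
  set w := Circle.exp θ
  refine ⟨-(1 / 2) * (conj (w : ℂ) * Y w).im, ?_⟩
  have hw : (w : ℂ) * conj (w : ℂ) = 1 := by
    rw [mul_conj, normSq_eq_norm_sq, Circle.norm_coe]
    simp
  have him := im_eq_sub_conj (conj (w : ℂ) * Y w)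
  push_cast
  rw [him, map_mul, conj_conj]
  field_simp
  linear_combination (4 * Y w) * hw

/-! ### Equivariance under isometries -/

/-- Third primitives pull back to third primitives under isometries, compatibly with the associated
vector fields. -/
theorem IsThirdPrimitive.exists_pullback {F f : ℂ → ℂ} (hF : IsThirdPrimitive F f) (γ : IsomPlus) :
    ∃ G : ℂ → ℂ, IsThirdPrimitive G (fun z => f (mapExt γ.1 z) * deriv (mapExt γ.1) z ^ 2) ∧
      pullback γ (toDisc (eichlerField F)) = toDisc (eichlerField G) := by
  obtain ⟨α, b, hα, hb, hγ⟩ := exists_moebius γ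
  have hαα : α * conj α = 1 := by
    rw [mul_conj, normSq_eq_norm_sq, hα]
    simp
  have hα0 : α ≠ 0 := left_ne_zero_of_mul_eq_one hαα
  have hk0 : 1 - b * conj b ≠ 0 := by
    rw [mul_conj, normSq_eq_norm_sq]
    have : 0 < 1 - ‖b‖ ^ 2 := by nlinarith [norm_nonneg b]
    exact_mod_cast this.ne'
  have hden : ∀ z ∈ disc, 1 + conj b * α * z ≠ 0 := fun z hz => by
    refine one_add_ne_zero_of_norm_lt ?_
    rw [norm_mul, norm_mul, hα, norm_conj]
    nlinarith [norm_nonneg b, norm_nonneg z, mem_disc.1 hz]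
  have hm : EqOn (mapExt γ.1) (fun z => (α * z + b) / (1 + conj b * α * z)) disc := fun z hz => by
    have h := hγ (UnitDisc.mk z (mem_disc.1 hz))
    rw [UnitDisc.coe_mk] at h
    rw [mapExt, discExt_of_norm_lt _ (mem_disc.1 hz)]
    exact h
  have hmd : ∀ z ∈ disc, HasDerivAt (mapExt γ.1)
      (α * (1 - b * conj b) / (1 + conj b * α * z) ^ 2) z := fun z hz => by
    have h1 : HasDerivAt (fun z => α * z + b) α z := by
      simpa using ((hasDerivAt_id z).const_mul α).add_const b
    have h2 : HasDerivAt (fun z => 1 + conj b * α * z) (conj b * α) z := by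
      simpa using ((hasDerivAt_id z).const_mul (conj b * α)).const_add 1
    refine ((h1.div h2 (hden z hz)).congr_of_eventuallyEq
      (hm.eventuallyEq_of_mem (isOpen_disc.mem_nhds hz))).congr_deriv ?_
    ring
  have hcomp : ∀ {H : ℂ → ℂ}, DifferentiableOn ℂ H disc → ∀ z ∈ disc,
      HasDerivAt (fun z => H (mapExt γ.1 z)) (deriv H (mapExt γ.1 z) *
        (α * (1 - b * conj b) / (1 + conj b * α * z) ^ 2)) z := fun hH z hz =>
    (hasDerivAt_of_disc hH (mapExt_mapsTo γ.1 hz)).comp z (hmd z hz)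
  set β := conj b * α with hβ
  have hlin : ∀ z, HasDerivAt (fun z => 1 + β * z) β z := fun z => by
    simpa using ((hasDerivAt_id z).const_mul β).const_add 1
  have hF1 := differentiableOn_deriv hF.1
  have hF2 := differentiableOn_deriv hF1
  set k := α * (1 - b * conj b) with hk
  have hkne : k ≠ 0 := mul_ne_zero hα0 hk0
  -- `G` is `(F ∘ γ) / γ'`, the transformation law of a vector field. `G₁` and `G₂` are its first
  -- two derivatives, and in the third all terms with `F`, `F'`, `F''` cancel because `γ` is Möbius.
  set G : ℂ → ℂ := fun z => F (mapExt γ.1 z) * ((1 + β * z) ^ 2 / k) with hG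
  set G₁ : ℂ → ℂ := fun z => deriv F (mapExt γ.1 z)
    + F (mapExt γ.1 z) * (2 * β * (1 + β * z) / k) with hG₁
  set G₂ : ℂ → ℂ := fun z => deriv (deriv F) (mapExt γ.1 z) * (k / (1 + β * z) ^ 2)
    + deriv F (mapExt γ.1 z) * (2 * β / (1 + β * z)) + F (mapExt γ.1 z) * (2 * β ^ 2 / k) with hG₂
  have d0 : ∀ z ∈ disc, HasDerivAt G (G₁ z) z := fun z hz => by
    have h0 := hden z hz
    refine ((hcomp hF.1 z hz).mul (((hlin z).pow 2).div_const k)).congr_deriv ?_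
    simp only [hG₁]
    field_simp
    simp
    ring
  have d1 : ∀ z ∈ disc, HasDerivAt G₁ (G₂ z) z := fun z hz => by
    have h0 := hden z hz
    refine ((hcomp hF1 z hz).add ((hcomp hF.1 z hz).mul
      (((hlin z).const_mul (2 * β)).div_const k))).congr_deriv ?_
    simp only [hG₂]
    field_simp
    ring
  have d2 : ∀ z ∈ disc, HasDerivAt G₂ (f (mapExt γ.1 z) * deriv (mapExt γ.1) z ^ 2) z :=
    fun z hz => by
    have h0 := hden z hz
    refine ((((hcomp hF2 z hz).mul ((hasDerivAt_const z k).div ((hlin z).pow 2)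
      (pow_ne_zero 2 h0))).add ((hcomp hF1 z hz).mul ((hasDerivAt_const z (2 * β)).div (hlin z)
      h0))).add ((hcomp hF.1 z hz).mul_const (2 * β ^ 2 / k))).congr_deriv ?_
    rw [(hmd z hz).deriv, hF.2 (mapExt_mapsTo γ.1 hz)]
    simp only [Pi.pow_apply, Pi.div_apply, zero_mul, zero_sub, Nat.cast_ofNat,
      Nat.add_one_sub_one, pow_one]
    field_simp
    ring
  refine ⟨G, isThirdPrimitive_of_hasDerivAt d0 d1 d2, ?_⟩
  funext z
  have hz := coe_mem_disc z
  have h0 := hden z hz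
  have e1 : deriv G z = G₁ z := eqOn_deriv_of_hasDerivAt d0 hz
  have e2 : deriv (deriv G) z = G₂ z := by
    rw [eqOn_deriv (eqOn_deriv_of_hasDerivAt d0) hz]
    exact eqOn_deriv_of_hasDerivAt d1 hz
  have hd : isomDeriv γ z = k / (1 + β * z) ^ 2 := (hmd z hz).deriv
  have hmz : mapExt γ.1 z = ((γ • z : 𝔻) : ℂ) := mapExt_coe γ.1 z
  have hγz : ((γ • z : 𝔻) : ℂ) = (α * z + b) / (1 + β * z) := hγ z
  simp only [pullback, toDisc, eichlerField, e1, e2, hd]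
  simp only [hG, hG₁, hG₂, hmz]
  generalize F ((γ • z : 𝔻) : ℂ) = A₀
  generalize deriv F ((γ • z : 𝔻) : ℂ) = A₁
  generalize deriv (deriv F) ((γ • z : 𝔻) : ℂ) = A₂
  rw [hγz]
  have hcα : conj α = α⁻¹ := eq_inv_of_mul_eq_one_right hαα
  have hc0 : α + b * conj (z : ℂ) ≠ 0 := by
    intro h
    apply h0
    have := congrArg conj h
    rw [map_add, map_mul, conj_conj, map_zero, hcα] at this
    rw [hβ]
    field_simp at this
    linear_combination this
  have hck : conj k = α⁻¹ * (1 - b * conj b) := by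
    rw [hk, map_mul, map_sub, map_mul, map_one, conj_conj, hcα]
    ring
  have hcβ : conj β = b * α⁻¹ := by rw [hβ, map_mul, conj_conj, hcα]
  simp only [map_mul, map_add, map_div₀, map_pow, map_one, map_ofNat, hcα, hck, hcβ]
  generalize conj (z : ℂ) = u at *
  have h1 : 1 + b * α⁻¹ * u ≠ 0 := by
    intro h
    apply hc0
    field_simp at h
    linear_combination h
  simp only [hk, hβ] at *
  generalize conj b = v at *
  generalize conj A₀ = B₀
  generalize conj A₁ = B₁
  generalize conj A₂ = B₂
  generalize (z : ℂ) = x at *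
  have hk1 : 1 - b * v ≠ 0 := hk0
  clear * - h0 hα0 hk1 h1
  -- From here `z` and `z̄` are independent variables `x` and `u`. `hS` is the invariance of `1 -
  -- |z|²` up to the factor `|γ'|`; with `hN` the image point enters only through `1 - x u` and the
  -- denominators, so these can be generalized before clearing fractions.
  have hS : 1 - (α * x + b) / (1 + v * α * x) * ((α⁻¹ * u + v) / (1 + b * α⁻¹ * u)) =
      (1 - b * v) * (1 - x * u) / ((1 + v * α * x) * (1 + b * α⁻¹ * u)) := by
    rw [div_mul_div_comm, eq_div_iff (mul_ne_zero h0 h1), sub_mul,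
      div_mul_cancel₀ _ (mul_ne_zero h0 h1)]
    linear_combination (x * v * b * u - x * u) * mul_inv_cancel₀ hα0
  have hN : α * x + b = b * (1 - x * u) + x * α * (1 + b * α⁻¹ * u) := by
    linear_combination -(x * b * u) * mul_inv_cancel₀ hα0
  rw [hS, hN]
  generalize 1 + b * α⁻¹ * u = E at *
  generalize 1 + v * α * x = D at *
  generalize 1 - b * v = κ at *
  generalize 1 - x * u = t
  field_simp
  ring

/-! ### The tension field of the Poincaré disc -/

theorem coord_eq (i : Fin 2) : coord i = fun z => (![reCLM, imCLM] i : ℂ →L[ℝ] ℝ) z := by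
  funext z
  fin_cases i <;> rfl

theorem contDiff_coord (i : Fin 2) : ContDiff ℝ ∞ (coord i) := by
  rw [coord_eq]
  exact (![reCLM, imCLM] i : ℂ →L[ℝ] ℝ).contDiff

theorem coord_coordVec (i j : Fin 2) : coord i (coordVec j) = if i = j then 1 else 0 := by
  fin_cases i <;> fin_cases j <;> simp [coord, coordVec]

theorem inner_coordVec (z : ℂ) (i : Fin 2) : inner ℝ z (coordVec i) = coord i z := by
  fin_cases i <;> simp [coord, coordVec, Complex.inner]

theorem partialD_of_hasFDerivAt {F : ℂ → ℝ} {L : ℂ →L[ℝ] ℝ} {z : ℂ} (h : HasFDerivAt F L z)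
    (i : Fin 2) : partialD i F z = L (coordVec i) := by
  rw [partialD, h.fderiv]

theorem partialD_congr {F G : ℂ → ℝ} (h : EqOn F G disc) (i : Fin 2) :
    EqOn (partialD i F) (partialD i G) disc := fun z hz => by
  simp only [partialD]
  rw [(h.eventuallyEq_of_mem (isOpen_disc.mem_nhds hz)).fderiv_eq]

theorem partialD_coord (i j : Fin 2) (z : ℂ) :
    partialD i (coord j) z = if j = i then 1 else 0 := by
  have h : HasFDerivAt (coord j) (![reCLM, imCLM] j : ℂ →L[ℝ] ℝ) z := by
    rw [coord_eq]
    exact (![reCLM, imCLM] j : ℂ →L[ℝ] ℝ).hasFDerivAt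
  rw [partialD_of_hasFDerivAt h, ← coord_coordVec, coord_eq]

theorem one_sub_norm_sq_pos_of_mem {z : ℂ} (hz : z ∈ disc) : 0 < 1 - ‖z‖ ^ 2 := by
  rw [mem_disc] at hz
  nlinarith [norm_nonneg z]

theorem metricMatrix_eq (z : ℂ) :
    metricMatrix z = (4 / (1 - ‖z‖ ^ 2) ^ 2) • (1 : Matrix (Fin 2) (Fin 2) ℝ) := by
  ext i j
  simp only [metricMatrix, Matrix.of_apply, discMetric, inner_coordVec, coord_coordVec,
    Matrix.smul_apply, Matrix.one_apply, smul_eq_mul, @eq_comm _ i j]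

theorem metricMatrix_inv {z : ℂ} (hz : z ∈ disc) (i j : Fin 2) :
    (metricMatrix z)⁻¹ i j = if i = j then (1 - ‖z‖ ^ 2) ^ 2 / 4 else 0 := by
  have h := (one_sub_norm_sq_pos_of_mem hz).ne'
  have hinv : (metricMatrix z)⁻¹ =
      ((1 - ‖z‖ ^ 2) ^ 2 / 4) • (1 : Matrix (Fin 2) (Fin 2) ℝ) := by
    refine Matrix.inv_eq_right_inv ?_
    rw [metricMatrix_eq, Matrix.smul_mul, Matrix.one_mul, smul_smul]
    rw [show 4 / (1 - ‖z‖ ^ 2) ^ 2 * ((1 - ‖z‖ ^ 2) ^ 2 / 4) = 1 by field_simp, one_smul]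
  rw [hinv]
  simp [Matrix.one_apply]

/-- The logarithmic derivative of the conformal factor of the hyperbolic metric. -/
noncomputable def logDensity (i : Fin 2) (z : ℂ) : ℝ := 4 * coord i z / (1 - ‖z‖ ^ 2)

theorem partialD_metricMatrix {z : ℂ} (hz : z ∈ disc) (i j l : Fin 2) :
    partialD i (fun p => metricMatrix p j l) z =
      if j = l then 4 / (1 - ‖z‖ ^ 2) ^ 2 * logDensity i z else 0 := by
  have h := (one_sub_norm_sq_pos_of_mem hz).ne'
  simp only [partialD, metricMatrix, Matrix.of_apply]
  rw [fderiv_discMetric _ _ _ hz, inner_coordVec, inner_coordVec, coord_coordVec, logDensity]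
  by_cases hjl : j = l
  · rw [if_pos hjl.symm, if_pos hjl]
    field_simp
    ring
  · rw [if_neg (Ne.symm hjl), if_neg hjl, mul_zero]

/-- The Christoffel symbols of a conformal metric depend only on the logarithmic derivative of its
conformal factor. -/
theorem christoffel_eq {z : ℂ} (hz : z ∈ disc) (k i j : Fin 2) :
    christoffel k i j z = 1 / 2 * ((if j = k then logDensity i z else 0) +
      (if i = k then logDensity j z else 0) - (if i = j then logDensity k z else 0)) := by
  have h := (one_sub_norm_sq_pos_of_mem hz).ne'
  simp only [christoffel, metricMatrix_inv hz, partialD_metricMatrix hz, ite_mul, zero_mul,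
    Finset.sum_ite_eq, Finset.mem_univ, if_true]
  split_ifs <;> field_simp <;> ring

/-- In dimension two the trace of the Christoffel symbols of a conformal source metric vanishes. The
source metric thus enters only as an overall factor in front of the flat Laplacian and the target
term. -/
theorem tension_eq {φ : ℂ → ℂ} {z : ℂ} (hz : z ∈ disc) (hφ : φ z ∈ disc) (a : Fin 2) :
    tension φ a z = (1 - ‖z‖ ^ 2) ^ 2 / 4 *
      (partialD 0 (partialD 0 fun p => coord a (φ p)) z
        + partialD 1 (partialD 1 fun p => coord a (φ p)) z
        + ∑ i, (logDensity 0 (φ z) * partialD i (fun p => coord 0 (φ p)) z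
            + logDensity 1 (φ z) * partialD i (fun p => coord 1 (φ p)) z)
              * partialD i (fun p => coord a (φ p)) z
        - 1 / 2 * logDensity a (φ z) * ∑ i, (partialD i (fun p => coord 0 (φ p)) z ^ 2
            + partialD i (fun p => coord 1 (φ p)) z ^ 2)) := by
  simp only [tension, metricMatrix_inv hz, christoffel_eq hz, christoffel_eq hφ, Fin.sum_univ_two]
  fin_cases a <;> simp <;> ring

theorem tension_congr {φ ψ : ℂ → ℂ} (h : EqOn φ ψ disc) {z : ℂ} (hz : z ∈ disc) (a : Fin 2) :
    tension φ a z = tension ψ a z := by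
  have hc : ∀ b, EqOn (fun p => coord b (φ p)) (fun p => coord b (ψ p)) disc := fun b p hp => by
    simp only [h hp]
  simp only [tension, h hz, partialD_congr (hc _) _ hz,
    partialD_congr (partialD_congr (hc _) _) _ hz]

/-! ### Smooth families -/

theorem contDiffOn_partialD {k : ℝ → ℂ → ℝ}
    (hk : ContDiffOn ℝ ∞ (fun p : ℝ × ℂ => k p.1 p.2) (univ ×ˢ disc)) (j : Fin 2) :
    ContDiffOn ℝ ∞ (fun p : ℝ × ℂ => partialD j (k p.1) p.2) (univ ×ˢ disc) := by
  have ho : IsOpen ((univ : Set ℝ) ×ˢ disc) := isOpen_univ.prod isOpen_disc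
  have h := (hk.fderiv_of_isOpen ho (m := ∞) le_rfl).clm_apply
    (contDiffOn_const (c := ((0 : ℝ), coordVec j)))
  refine h.congr fun p hp => ?_
  have hd : HasFDerivAt (fun p : ℝ × ℂ => k p.1 p.2) _ (p.1, p.2) :=
    ((hk.contDiffAt (ho.mem_nhds hp)).differentiableAt (by simp)).hasFDerivAt
  have hd2 := hd.comp p.2 (hasFDerivAt_prodMk_right p.1 p.2)
  exact partialD_of_hasFDerivAt hd2 j

theorem contDiffOn_partialD_const {k : ℂ → ℝ} (hk : ContDiffOn ℝ ∞ k disc) (j : Fin 2) :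
    ContDiffOn ℝ ∞ (partialD j k) disc :=
  (hk.fderiv_of_isOpen isOpen_disc (m := ∞) le_rfl).clm_apply contDiffOn_const

theorem contDiffOn_slice {k : ℝ → ℂ → ℝ}
    (hk : ContDiffOn ℝ ∞ (fun p : ℝ × ℂ => k p.1 p.2) (univ ×ˢ disc)) (t : ℝ) :
    ContDiffOn ℝ ∞ (k t) disc :=
  hk.comp (contDiffOn_const.prodMk contDiffOn_id) fun _ hz => ⟨mem_univ t, hz⟩

theorem continuous_slice {k : ℝ → ℂ → ℝ}
    (hk : ContDiffOn ℝ ∞ (fun p : ℝ × ℂ => k p.1 p.2) (univ ×ˢ disc)) {z : ℂ} (hz : z ∈ disc) :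
    Continuous fun t => k t z :=
  hk.continuousOn.comp_continuous (by fun_prop : Continuous fun t : ℝ => (t, z))
    fun t => ⟨mem_univ t, hz⟩

/-- The difference quotient at `0` is `g` itself, so continuity suffices. This gives time
derivatives of spatial derivatives of the deformation without interchanging the two kinds of
differentiation. -/
theorem hasDerivAt_add_mul {g : ℝ → ℝ} (hg : Continuous g) (c : ℝ) :
    HasDerivAt (fun t => c + t * g t) (g 0) 0 := by
  rw [hasDerivAt_iff_tendsto_slope]
  refine (hg.continuousAt.tendsto.mono_left nhdsWithin_le_nhds).congr' ?_
  filter_upwards [self_mem_nhdsWithin] with t ht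
  have ht' : t ≠ 0 := ht
  rw [slope_def_field]
  field_simp
  ring

theorem partialD_add_mul {k h : ℂ → ℝ} {z : ℂ} (hh : DifferentiableAt ℝ h z)
    (hk : DifferentiableAt ℝ k z) (t : ℝ) (i : Fin 2) :
    partialD i (fun p => h p + t * k p) z = partialD i h z + t * partialD i k z := by
  exact partialD_of_hasFDerivAt (F := fun p => h p + t * k p)
    (hh.hasFDerivAt.add (hk.hasFDerivAt.const_mul t)) i

theorem partialD_comm {u : ℂ → ℝ} (hu : ContDiffOn ℝ ∞ u disc) {z : ℂ} (hz : z ∈ disc)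
    (i j : Fin 2) : partialD i (partialD j u) z = partialD j (partialD i u) z := by
  have hs : IsSymmSndFDerivAt ℝ u z := (hu.contDiffAt (isOpen_disc.mem_nhds hz)).isSymmSndFDerivAt
    (by simpa using ENat.LEInfty.out)
  have hd : DifferentiableAt ℝ (fderiv ℝ u) z :=
    ((hu.fderiv_of_isOpen isOpen_disc (m := ∞) le_rfl).contDiffAt
      (isOpen_disc.mem_nhds hz)).differentiableAt (by simp)
  have h2 : ∀ i j, partialD i (partialD j u) z
      = fderiv ℝ (fderiv ℝ u) z (coordVec i) (coordVec j) := fun i j => by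
    have h := hd.hasFDerivAt.clm_apply (hasFDerivAt_const (coordVec j) z)
    exact (partialD_of_hasFDerivAt h i).trans (by simp)
  rw [h2, h2, hs]

/-! ### Harmonicity -/

theorem differentiableAt_of_contDiffOn_disc {E : Type*} [NormedAddCommGroup E] [NormedSpace ℝ E]
    {u : ℂ → E} (hu : ContDiffOn ℝ ∞ u disc) {z : ℂ} (hz : z ∈ disc) : DifferentiableAt ℝ u z :=
  (hu.contDiffAt (isOpen_disc.mem_nhds hz)).differentiableAt (by simp)

theorem partialD_add {u v : ℂ → ℝ} {z : ℂ} (hu : DifferentiableAt ℝ u z)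
    (hv : DifferentiableAt ℝ v z) (i : Fin 2) :
    partialD i (fun p => u p + v p) z = partialD i u z + partialD i v z :=
  partialD_of_hasFDerivAt (F := fun p => u p + v p) (hu.hasFDerivAt.add hv.hasFDerivAt) i

theorem partialD_sub {u v : ℂ → ℝ} {z : ℂ} (hu : DifferentiableAt ℝ u z)
    (hv : DifferentiableAt ℝ v z) (i : Fin 2) :
    partialD i (fun p => u p - v p) z = partialD i u z - partialD i v z :=
  partialD_of_hasFDerivAt (F := fun p => u p - v p) (hu.hasFDerivAt.sub hv.hasFDerivAt) i

theorem partialD_mul {u v : ℂ → ℝ} {z : ℂ} (hu : DifferentiableAt ℝ u z)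
    (hv : DifferentiableAt ℝ v z) (i : Fin 2) :
    partialD i (fun p => u p * v p) z = u z * partialD i v z + v z * partialD i u z :=
  partialD_of_hasFDerivAt (F := fun p => u p * v p) (hu.hasFDerivAt.mul hv.hasFDerivAt) i

theorem partialD_coord_holomorphic {f : ℂ → ℂ} (hf : DifferentiableOn ℂ f disc) {z : ℂ}
    (hz : z ∈ disc) (i j : Fin 2) :
    partialD i (fun p => coord j (f p)) z = coord j (deriv f z * coordVec i) := by
  have h := (hasDerivAt_of_disc hf hz).complexToReal_fderiv
  rw [coord_eq]
  exact (partialD_of_hasFDerivAt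
    ((![reCLM, imCLM] j : ℂ →L[ℝ] ℝ).hasFDerivAt.comp z h) i).trans (by simp)

theorem hasFDerivAt_weight (z : ℂ) :
    HasFDerivAt (fun p : ℂ => (1 - ‖p‖ ^ 2) ^ 2 / 4) (-(1 - ‖z‖ ^ 2) • innerSL ℝ z) z := by
  have h1 : HasFDerivAt (fun p : ℂ => ‖p‖ ^ 2) (2 • (innerSL ℝ z)) z :=
    (hasStrictFDerivAt_norm_sq z).hasFDerivAt
  have h2 := (((h1.const_sub 1).pow 2).mul_const (1 / 4))
  simp only [mul_one_div] at h2
  refine h2.congr_fderiv ?_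
  ext
  · simp; ring

theorem partialD_weight (z : ℂ) (i : Fin 2) :
    partialD i (fun p : ℂ => (1 - ‖p‖ ^ 2) ^ 2 / 4) z = -(1 - ‖z‖ ^ 2) * coord i z := by
  rw [partialD_of_hasFDerivAt (hasFDerivAt_weight z), ← inner_coordVec]
  simp

theorem contDiffOn_coord {X : ℂ → ℂ} (hX : ContDiffOn ℝ ∞ X disc) (a : Fin 2) :
    ContDiffOn ℝ ∞ (fun p => coord a (X p)) disc :=
  (contDiff_coord a).comp_contDiffOn hX

theorem cauchyRiemann_components {X f : ℂ → ℂ} (hX : ContDiffOn ℝ ∞ X disc)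
    (hd : ∀ z ∈ disc, HasDbarAt X ((1 - z * conj z) ^ 2 / 4 * conj (f z)) z) :
    EqOn (fun z => partialD 0 (fun p => coord 0 (X p)) z -
      partialD 1 (fun p => coord 1 (X p)) z)
      (fun z => (1 - ‖z‖ ^ 2) ^ 2 / 4 * coord 0 (f z)) disc ∧
    EqOn (fun z => partialD 1 (fun p => coord 0 (X p)) z +
      partialD 0 (fun p => coord 1 (X p)) z)
      (fun z => -((1 - ‖z‖ ^ 2) ^ 2 / 4 * coord 1 (f z))) disc := by
  have key : ∀ z ∈ disc, fderiv ℝ X z 1 + I * fderiv ℝ X z I =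
      (((1 - ‖z‖ ^ 2) ^ 2 / 4 : ℝ) : ℂ) * conj (f z) := fun z hz => by
    rw [(hasDbarAt_self (differentiableAt_of_contDiffOn_disc hX hz)).unique (hd z hz), mul_conj,
      normSq_eq_norm_sq]
    push_cast
    rfl
  have hp : ∀ z ∈ disc, ∀ i j, partialD i (fun p => coord j (X p)) z =
      coord j (fderiv ℝ X z (coordVec i)) := fun z hz i j => by
    have h := (differentiableAt_of_contDiffOn_disc hX hz).hasFDerivAt
    rw [coord_eq]
    exact partialD_of_hasFDerivAt ((![reCLM, imCLM] j : ℂ →L[ℝ] ℝ).hasFDerivAt.comp z h) i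
  refine ⟨fun z hz => ?_, fun z hz => ?_⟩
  · have h := congrArg re (key z hz)
    rw [re_ofReal_mul] at h
    simp only [hp z hz]
    simpa [coord, coordVec, sub_eq_add_neg] using h
  · have h := congrArg im (key z hz)
    rw [im_ofReal_mul] at h
    simp only [hp z hz]
    simp only [coord, coordVec]
    simp at h ⊢
    linarith

/-- The linearized tension field of `X` vanishes when `f` is holomorphic. -/
theorem linearized_tension_eq_zero {X f : ℂ → ℂ} (hX : ContDiffOn ℝ ∞ X disc)
    (hf : DifferentiableOn ℂ f disc)
    (hd : ∀ z ∈ disc, HasDbarAt X ((1 - z * conj z) ^ 2 / 4 * conj (f z)) z)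
    {z : ℂ} (hz : z ∈ disc) :
    (partialD 0 (partialD 0 fun p => coord 0 (X p)) z
      + partialD 1 (partialD 1 fun p => coord 0 (X p)) z
      + logDensity 0 z * (partialD 0 (fun p => coord 0 (X p)) z
        - partialD 1 (fun p => coord 1 (X p)) z)
      + logDensity 1 z * (partialD 1 (fun p => coord 0 (X p)) z
        + partialD 0 (fun p => coord 1 (X p)) z) = 0) ∧
    (partialD 0 (partialD 0 fun p => coord 1 (X p)) z
      + partialD 1 (partialD 1 fun p => coord 1 (X p)) z
      - logDensity 1 z * (partialD 0 (fun p => coord 0 (X p)) z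
        - partialD 1 (fun p => coord 1 (X p)) z)
      + logDensity 0 z * (partialD 1 (fun p => coord 0 (X p)) z
        + partialD 0 (fun p => coord 1 (X p)) z) = 0) := by
  obtain ⟨hp, hq⟩ := cauchyRiemann_components hX hd
  have hm := (one_sub_norm_sq_pos_of_mem hz).ne'
  have hdu : ∀ a i, DifferentiableAt ℝ (partialD i fun p => coord a (X p)) z := fun a i =>
    differentiableAt_of_contDiffOn_disc (contDiffOn_partialD_const (contDiffOn_coord hX a) i) hz
  have hw := (hasFDerivAt_weight z).differentiableAt
  have hdf : ∀ j, DifferentiableAt ℝ (fun p => coord j (f p)) z := fun j =>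
    ((contDiff_coord j).differentiable (by simp)).differentiableAt.comp z
      (hf.differentiableAt (isOpen_disc.mem_nhds hz)).real_of_complex
  -- With `P = u_x - v_y` and `Q = u_y + v_x`, symmetry of second derivatives gives `Δu = P_x + Q_y`
  -- and `Δv = Q_x - P_y`. The Cauchy-Riemann equations for `f` remove the derivatives of `f`, and
  -- the derivatives of the weight cancel the `logDensity` terms.
  have hpi : ∀ i, partialD i (partialD 0 fun p => coord 0 (X p)) z -
      partialD i (partialD 1 fun p => coord 1 (X p)) z =
      (1 - ‖z‖ ^ 2) ^ 2 / 4 * coord 0 (deriv f z * coordVec i) +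
        coord 0 (f z) * (-(1 - ‖z‖ ^ 2) * coord i z) := fun i => by
    rw [← partialD_sub (hdu 0 0) (hdu 1 1), partialD_congr hp i hz, partialD_mul hw (hdf 0),
      partialD_weight, partialD_coord_holomorphic hf hz]
  have hqi : ∀ i, partialD i (partialD 1 fun p => coord 0 (X p)) z +
      partialD i (partialD 0 fun p => coord 1 (X p)) z =
      -((1 - ‖z‖ ^ 2) ^ 2 / 4 * coord 1 (deriv f z * coordVec i) +
        coord 1 (f z) * (-(1 - ‖z‖ ^ 2) * coord i z)) := fun i => by
    rw [← partialD_add (hdu 0 1) (hdu 1 0), partialD_congr hq i hz, ← partialD_weight,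
      ← partialD_coord_holomorphic hf hz, ← partialD_mul hw (hdf 1)]
    simp only [partialD]
    rw [fderiv_fun_neg]
    rfl
  have hp0 := hp hz
  have hq0 := hq hz
  have c0 := partialD_comm (contDiffOn_coord hX 0) hz 0 1
  have c1 := partialD_comm (contDiffOn_coord hX 1) hz 0 1
  have p0 := hpi 0
  have p1 := hpi 1
  have q0 := hqi 0
  have q1 := hqi 1
  simp only at hp0 hq0
  rw [hp0, hq0]
  simp only [logDensity]
  simp only [coord, coordVec, Matrix.cons_val_zero, Matrix.cons_val_one, mul_re, mul_im, one_re,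
    one_im, I_re, I_im] at *
  constructor
  · field_simp
    linarith
  · field_simp
    linarith

/-- A deformation of the identity of the disc with initial velocity `X`, minus the identity and
divided by the time parameter. -/
noncomputable def flowQuotient (X : ℂ → ℂ) (t : ℝ) (z : ℂ) : ℂ :=
  (1 + t ^ 2 * ‖X z‖ ^ 2 / (1 - ‖z‖ ^ 2) ^ 2)⁻¹ • X z

theorem flowQuotient_zero (X : ℂ → ℂ) (z : ℂ) : flowQuotient X 0 z = X z := by
  simp [flowQuotient]

/-- With `m = 1 - |z|²`, the damping factor in `flowQuotient` keeps the displacement at most `m /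
2`, by `2 a m ≤ a² + m²`, and `|z| + m / 2 = 1 - (1 - |z|)² / 2 < 1`. The factor differs from `1`
only at order `t²`, so the initial velocity is still `X`. -/
theorem norm_add_flowQuotient_lt (X : ℂ → ℂ) (t : ℝ) {z : ℂ} (hz : ‖z‖ < 1) :
    ‖z + t * flowQuotient X t z‖ < 1 := by
  have hm := one_sub_norm_sq_pos_of_mem (mem_disc.2 hz)
  set m := 1 - ‖z‖ ^ 2 with hmdef
  set a := |t| * ‖X z‖ with ha
  have haa : t ^ 2 * ‖X z‖ ^ 2 = a ^ 2 := by rw [ha, mul_pow, sq_abs]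
  have hnorm : ‖(t : ℂ) * flowQuotient X t z‖ = (1 + a ^ 2 / m ^ 2)⁻¹ * a := by
    rw [norm_mul, flowQuotient, norm_smul, haa, norm_real, Real.norm_eq_abs,
      Real.norm_of_nonneg (by positivity), ha]
    ring
  have hle : (1 + a ^ 2 / m ^ 2)⁻¹ * a ≤ m / 2 := by
    rw [inv_mul_le_iff₀ (by positivity)]
    have : (1 + a ^ 2 / m ^ 2) * (m / 2) = (m ^ 2 + a ^ 2) / (2 * m) := by field_simp
    rw [this, le_div_iff₀ (by positivity)]
    nlinarith [sq_nonneg (m - a)]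
  have h := norm_add_le z (t * flowQuotient X t z)
  rw [hnorm] at h
  nlinarith [sq_nonneg (1 - ‖z‖)]

/-- The deformation of the identity with initial velocity `X`. -/
noncomputable def flow (X : ℂ → ℂ) (t : ℝ) (z : 𝔻) : 𝔻 :=
  UnitDisc.mk (z + t * flowQuotient X t z) (norm_add_flowQuotient_lt X t z.norm_lt_one)

theorem mapExt_flow (X : ℂ → ℂ) (t : ℝ) :
    EqOn (mapExt (flow X t)) (fun z => z + t * flowQuotient X t z) disc := fun z hz => by
  rw [mapExt, discExt_of_norm_lt _ (mem_disc.1 hz)]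
  simp [flow]

theorem contDiffOn_flowQuotient {X : ℂ → ℂ} (hX : ContDiffOn ℝ ∞ X disc) :
    ContDiffOn ℝ ∞ (fun p : ℝ × ℂ => flowQuotient X p.1 p.2) (univ ×ˢ disc) := by
  have h2 : ContDiffOn ℝ ∞ (fun p : ℝ × ℂ => X p.2) (univ ×ˢ disc) :=
    hX.comp contDiffOn_snd fun p hp => hp.2
  have h3 : ContDiffOn ℝ ∞ (fun p : ℝ × ℂ => (1 - ‖p.2‖ ^ 2) ^ 2) (univ ×ˢ disc) :=
    (contDiffOn_const.sub (contDiffOn_snd.norm_sq ℝ)).pow 2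
  refine ContDiffOn.smul (ContDiffOn.inv (contDiffOn_const.add
    (((contDiffOn_fst.pow 2).mul (h2.norm_sq ℝ)).div h3 fun p hp => ?_)) fun p hp => ?_) h2
  · exact pow_ne_zero 2 (one_sub_norm_sq_pos_of_mem hp.2).ne'
  · exact (by positivity : (0 : ℝ) < 1 + p.1 ^ 2 * ‖X p.2‖ ^ 2 / (1 - ‖p.2‖ ^ 2) ^ 2).ne'

theorem coord_add_mul (a : Fin 2) (t : ℝ) (z w : ℂ) :
    coord a (z + t * w) = coord a z + t * coord a w := by
  fin_cases a <;> simp [coord]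

theorem contDiffOn_coord_flowQuotient {X : ℂ → ℂ} (hX : ContDiffOn ℝ ∞ X disc) (a : Fin 2) :
    ContDiffOn ℝ ∞ (fun p : ℝ × ℂ => coord a (flowQuotient X p.1 p.2)) (univ ×ˢ disc) :=
  (contDiff_coord a).comp_contDiffOn (contDiffOn_flowQuotient hX)

theorem partialD_flow {X : ℂ → ℂ} (hX : ContDiffOn ℝ ∞ X disc) (a j : Fin 2) (t : ℝ)
    {z : ℂ} (hz : z ∈ disc) :
    partialD j (fun p => coord a (p + t * flowQuotient X t p)) z =
      (if a = j then 1 else 0) + t * partialD j (fun p => coord a (flowQuotient X t p)) z := by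
  simp only [coord_add_mul]
  rw [← partialD_coord]
  exact partialD_add_mul (((contDiff_coord a).differentiable (by simp)).differentiableAt)
    (differentiableAt_of_contDiffOn_disc (contDiffOn_slice
      (k := fun t p => coord a (flowQuotient X t p)) (contDiffOn_coord_flowQuotient hX a) t) hz) t j

theorem partialD_partialD_flow {X : ℂ → ℂ} (hX : ContDiffOn ℝ ∞ X disc) (a i j : Fin 2) (t : ℝ)
    {z : ℂ} (hz : z ∈ disc) :
    partialD i (partialD j fun p => coord a (p + t * flowQuotient X t p)) z =
      0 + t * partialD i (partialD j fun p => coord a (flowQuotient X t p)) z := by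
  rw [partialD_congr (fun w hw => partialD_flow hX a j t hw) i hz]
  have hc : partialD i (fun _ => if a = j then (1 : ℝ) else 0) z = 0 := by
    rw [partialD_of_hasFDerivAt (hasFDerivAt_const _ z)]
    rfl
  have h := partialD_add_mul (differentiableAt_const (if a = j then (1 : ℝ) else 0))
    (differentiableAt_of_contDiffOn_disc (contDiffOn_partialD_const (contDiffOn_slice
      (k := fun t p => coord a (flowQuotient X t p)) (contDiffOn_coord_flowQuotient hX a) t) j) hz)
    t i
  rwa [hc] at h

theorem hasDerivAt_partialD_flow {X : ℂ → ℂ} (hX : ContDiffOn ℝ ∞ X disc) (a j : Fin 2)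
    {z : ℂ} (hz : z ∈ disc) :
    HasDerivAt (fun t : ℝ => partialD j (fun p => coord a (p + t * flowQuotient X t p)) z)
      (partialD j (fun p => coord a (X p)) z) 0 := by
  have h := hasDerivAt_add_mul (continuous_slice
    (k := fun t => partialD j fun p => coord a (flowQuotient X t p)) (contDiffOn_partialD
    (k := fun t p => coord a (flowQuotient X t p)) (contDiffOn_coord_flowQuotient hX a) j) hz)
    (if a = j then 1 else 0)
  simp only [flowQuotient_zero] at h
  simpa only [partialD_flow hX a j _ hz] using h

theorem hasDerivAt_partialD_partialD_flow {X : ℂ → ℂ} (hX : ContDiffOn ℝ ∞ X disc) (a i j : Fin 2)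
    {z : ℂ} (hz : z ∈ disc) :
    HasDerivAt
      (fun t : ℝ => partialD i (partialD j fun p => coord a (p + t * flowQuotient X t p)) z)
      (partialD i (partialD j fun p => coord a (X p)) z) 0 := by
  have h := hasDerivAt_add_mul (continuous_slice
    (k := fun t => partialD i (partialD j fun p => coord a (flowQuotient X t p)))
    (contDiffOn_partialD
    (k := fun t => partialD j fun p => coord a (flowQuotient X t p)) (contDiffOn_partialD
      (k := fun t p => coord a (flowQuotient X t p)) (contDiffOn_coord_flowQuotient hX a) j) i) hz)
    0
  simp only [flowQuotient_zero] at h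
  simpa only [partialD_partialD_flow hX a i j _ hz] using h

theorem contDiff_flowQuotient_time (X : ℂ → ℂ) (z : ℂ) :
    ContDiff ℝ ∞ fun t : ℝ => flowQuotient X t z := by
  refine ContDiff.smul (ContDiff.inv (contDiff_const.add
    (((contDiff_id.pow 2).mul contDiff_const).div_const _)) fun t => ?_) contDiff_const
  exact (by positivity : (0 : ℝ) < 1 + t ^ 2 * ‖X z‖ ^ 2 / (1 - ‖z‖ ^ 2) ^ 2).ne'

theorem contDiff_flow_time (X : ℂ → ℂ) (z : ℂ) :
    ContDiff ℝ ∞ fun t : ℝ => z + t * flowQuotient X t z :=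
  contDiff_const.add (ofRealCLM.contDiff.mul (contDiff_flowQuotient_time X z))

theorem hasDerivAt_flow (X : ℂ → ℂ) (z : ℂ) :
    HasDerivAt (fun t : ℝ => z + t * flowQuotient X t z) (X z) 0 := by
  have h := contDiff_flowQuotient_time X z
  have h1 : HasDerivAt (fun t : ℝ => flowQuotient X t z) _ 0 :=
    ((h.differentiable (by simp)) 0).hasDerivAt
  refine (((ofRealCLM.hasDerivAt (x := 0)).mul h1).const_add z).congr_deriv ?_
  simp [flowQuotient_zero]

theorem exists_hasDerivAt_logDensity_flow (X : ℂ → ℂ) (i : Fin 2) {z : ℂ} (hz : z ∈ disc) :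
    ∃ l, HasDerivAt (fun t : ℝ => logDensity i (z + t * flowQuotient X t z)) l 0 := by
  have h := (contDiff_flow_time X z).differentiable (by simp) 0
  refine ⟨_, DifferentiableAt.hasDerivAt (DifferentiableAt.div ?_ ?_ ?_)⟩
  · exact (((contDiff_coord i).differentiable (by simp)).differentiableAt.comp 0 h).const_mul 4
  · exact (h.norm_sq ℝ).const_sub 1
  · simpa using (one_sub_norm_sq_pos_of_mem hz).ne'

theorem hasDerivAt_tension_flow {X f : ℂ → ℂ} (hX : ContDiffOn ℝ ∞ X disc)
    (hf : DifferentiableOn ℂ f disc)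
    (hd : ∀ z ∈ disc, HasDbarAt X ((1 - z * conj z) ^ 2 / 4 * conj (f z)) z)
    {z : ℂ} (hz : z ∈ disc) (a : Fin 2) :
    HasDerivAt (fun t : ℝ => tension (fun p => p + t * flowQuotient X t p) a z) 0 0 := by
  have ht : ∀ t : ℝ, tension (fun p => p + t * flowQuotient X t p) a z = _ := fun t =>
    tension_eq hz (mem_disc.2 (norm_add_flowQuotient_lt X t (mem_disc.1 hz))) a
  simp only [ht, Fin.sum_univ_two]
  -- Only existence of these derivatives is needed: at the identity map their contributions to the
  -- two target terms cancel.
  obtain ⟨l0, hl0⟩ := exists_hasDerivAt_logDensity_flow X 0 hz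
  obtain ⟨l1, hl1⟩ := exists_hasDerivAt_logDensity_flow X 1 hz
  obtain ⟨la, hla⟩ := exists_hasDerivAt_logDensity_flow X a hz
  have hP := fun b i => hasDerivAt_partialD_flow hX b i hz
  have hQ := fun b i => hasDerivAt_partialD_partialD_flow hX b i i hz
  obtain ⟨e0, e1⟩ := linearized_tension_eq_zero hX hf hd hz
  have hmain := (((((hQ a 0).add (hQ a 1)).add
    ((((hl0.mul (hP 0 0)).add (hl1.mul (hP 1 0))).mul (hP a 0)).add
      (((hl0.mul (hP 0 1)).add (hl1.mul (hP 1 1))).mul (hP a 1)))).sub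
    ((hla.const_mul (1 / 2)).mul ((((hP 0 0).pow 2).add ((hP 1 0).pow 2)).add
      (((hP 0 1).pow 2).add ((hP 1 1).pow 2))))).const_mul ((1 - ‖z‖ ^ 2) ^ 2 / 4))
  refine hmain.congr_deriv ?_
  clear hmain ht
  have hz0 : z + ((0 : ℝ) : ℂ) * flowQuotient X 0 z = z := by simp
  have hP0 : ∀ b i, partialD i (fun p => coord b (p + ((0 : ℝ) : ℂ) * flowQuotient X 0 p)) z =
      if b = i then 1 else 0 := fun b i => by
    rw [partialD_flow hX b i 0 hz]
    simp
  simp only [hP0, Pi.add_apply, Pi.mul_apply, Pi.pow_apply, hz0]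
  fin_cases a
  · have hll : la = l0 := hla.unique hl0
    subst hll
    simp
    right
    linear_combination e0
  · have hll : la = l1 := hla.unique hl1
    subst hll
    simp
    right
    linear_combination e1

theorem isHarmonic_toDisc {X f : ℂ → ℂ} (hX : ContDiffOn ℝ ∞ X disc)
    (hf : DifferentiableOn ℂ f disc)
    (hd : ∀ z ∈ disc, HasDbarAt X ((1 - z * conj z) ^ 2 / 4 * conj (f z)) z) :
    IsHarmonic (toDisc X) := by
  refine ⟨isSmooth_toDisc hX, 1, one_pos, flow X, ?_, fun z => ?_, fun z => ?_, fun z a => ?_⟩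
  · have h : ContDiffOn ℝ ∞ (fun p : ℝ × ℂ => p.2 + p.1 * flowQuotient X p.1 p.2)
        (univ ×ˢ disc) :=
      contDiffOn_snd.add ((ofRealCLM.contDiff.comp_contDiffOn contDiffOn_fst).mul
        (contDiffOn_flowQuotient hX))
    exact (h.mono (prod_mono (subset_univ _) Subset.rfl)).congr fun p hp => mapExt_flow X p.1 hp.2
  · refine UnitDisc.coe_injective ?_
    simp [flow]
  · simpa only [flow, UnitDisc.coe_mk, toDisc] using
      (hasDerivAt_flow X z).hasDerivWithinAt
  · simp only [fun t => tension_congr (mapExt_flow X t) (coe_mem_disc z) a]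
    exact (hasDerivAt_tension_flow hX hf hd (coe_mem_disc z) a).hasDerivWithinAt

/-! ### Cocompactness -/

/-- An invariant continuous function descends to the compact quotient. -/
theorem exists_bound_of_invariant {Γ : Subgroup IsomPlus}
    (hcocompact : CompactSpace (MulAction.orbitRel.Quotient Γ 𝔻)) {g : 𝔻 → ℝ} (hg : Continuous g)
    (hinv : ∀ γ ∈ Γ, ∀ z, g (γ • z) = g z) : ∃ C, ∀ z, g z ≤ C := by
  let G : MulAction.orbitRel.Quotient Γ 𝔻 → ℝ := Quotient.lift g (by
    rintro a b ⟨γ, rfl⟩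
    exact hinv γ γ.2 b)
  have hG : Continuous G := hg.quotient_lift _
  obtain ⟨C, hC⟩ := (isCompact_range hG).bddAbove
  exact ⟨C, fun z => hC ⟨Quotient.mk _ z, rfl⟩⟩

theorem continuous_of_continuousOn_discExt {X : 𝔻 → ℂ} (h : ContinuousOn (discExt X) disc) :
    Continuous X := by
  have h' := h.comp_continuous UnitDisc.continuous_coe coe_mem_disc
  exact h'.congr fun z => discExt_coe X z

theorem continuous_one_sub_norm_sq : Continuous fun z : 𝔻 => 1 - ‖(z : ℂ)‖ ^ 2 :=
  continuous_const.sub (UnitDisc.continuous_coe.norm.pow 2)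

/-- Quadratic differentials on cocompact quotients are bounded in the hyperbolic metric. -/
theorem exists_bound_of_mem_HQD {Γ : Subgroup IsomPlus}
    (hcocompact : CompactSpace (MulAction.orbitRel.Quotient Γ 𝔻)) {q : 𝔻 → ℂ} (hq : q ∈ HQD Γ) :
    ∃ C, ∀ z ∈ disc, ‖discExt q z‖ * (1 - ‖z‖ ^ 2) ^ 2 ≤ C := by
  obtain ⟨C, hC⟩ := exists_bound_of_invariant hcocompact
    (g := fun z => ‖q z‖ * (1 - ‖(z : ℂ)‖ ^ 2) ^ 2)
    ((continuous_of_continuousOn_discExt hq.1.continuousOn).norm.mul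
      (continuous_one_sub_norm_sq.pow 2)) (fun γ hγ z => by
      have h1 := one_sub_norm_sq_pos z
      rw [← hq.2 γ hγ z, norm_mul, norm_pow, norm_isomDeriv]
      field_simp)
  refine ⟨C, fun z hz => ?_⟩
  rw [discExt_of_norm_lt _ (mem_disc.1 hz)]
  exact hC (UnitDisc.mk z (mem_disc.1 hz))

/-- Invariant vector fields on cocompact quotients vanish at the boundary. -/
theorem hasHoelderLimit_zero_of_invariant {Γ : Subgroup IsomPlus}
    (hcocompact : CompactSpace (MulAction.orbitRel.Quotient Γ 𝔻)) {X : 𝔻 → ℂ}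
    (hX : Continuous X) (hinv : ∀ γ ∈ Γ, pullback γ X = X) : HasHoelderLimit (discExt X) 0 := by
  -- This quotient is half the hyperbolic length of `X`, which is invariant because `|γ'|` is the
  -- ratio of the values of `1 - |z|²`.
  obtain ⟨C, hC⟩ := exists_bound_of_invariant hcocompact
    (g := fun z => ‖X z‖ / (1 - ‖(z : ℂ)‖ ^ 2))
    (hX.norm.div continuous_one_sub_norm_sq fun z => (one_sub_norm_sq_pos z).ne') (fun γ hγ z => by
      have h1 := one_sub_norm_sq_pos z
      have h2 := one_sub_norm_sq_pos (γ • z)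
      rw [← congrFun (hinv γ hγ) z, pullback, norm_mul, norm_inv, norm_isomDeriv]
      field_simp)
  have hC0 : 0 ≤ C := le_trans (div_nonneg (norm_nonneg _) (one_sub_norm_sq_pos 0).le) (hC 0)
  refine ⟨2 * C, fun r hr hr1 w => ?_⟩
  have hn : ‖(r : ℂ) * w‖ = r := by
    rw [norm_mul, Circle.norm_coe, norm_real, Real.norm_of_nonneg hr, mul_one]
  have h := hC (UnitDisc.mk (r * w) (by rwa [hn]))
  simp only [UnitDisc.coe_mk, hn] at h
  rw [div_le_iff₀ (by nlinarith)] at h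
  rw [Pi.zero_apply, sub_zero, discExt_of_norm_lt _ (by rwa [hn])]
  have h1 : 1 - r ≤ √(1 - r) := Real.le_sqrt_of_sq_le (by nlinarith)
  calc _ ≤ C * (1 - r ^ 2) := h
    _ ≤ C * (2 * √(1 - r)) := by gcongr; nlinarith
    _ = 2 * C * √(1 - r) := by ring

/-! ### Existence and structure of potentials -/

theorem hasDbarAt_toDisc {X : ℂ → ℂ} {d z : ℂ} (hz : z ∈ disc) (h : HasDbarAt X d z) :
    HasDbarAt (discExt (toDisc X)) d z :=
  h.congr hz (discExt_toDisc X).symm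

theorem isPotential_eichlerField {q : 𝔻 → ℂ} (hq : DifferentiableOn ℂ (discExt q) disc) {C : ℝ}
    (hC : ∀ z ∈ disc, ‖discExt q z‖ * (1 - ‖z‖ ^ 2) ^ 2 ≤ C) {F : ℂ → ℂ}
    (hF : IsThirdPrimitive F (discExt q)) : IsPotential q (toDisc (eichlerField F)) := by
  have hsm := contDiffOn_eichlerField hF.1
  refine ⟨isHarmonic_toDisc hsm hq fun z hz => hF.hasDbarAt hz, fun z => ?_, ?_⟩
  · have hz := coe_mem_disc z
    rw [quadraticPart_lieMetric (hasDbarAt_toDisc hz (hF.hasDbarAt hz)), discExt_coe]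
    have h1 : (1 - z * conj (z : ℂ)) ≠ 0 := by
      rw [mul_conj, normSq_eq_norm_sq]
      exact_mod_cast (one_sub_norm_sq_pos z).ne'
    have h2 : (1 - conj (z : ℂ) * z) ≠ 0 := by rwa [mul_comm]
    simp only [map_mul, map_div₀, map_pow, map_sub, map_one, conj_conj, map_ofNat]
    field_simp
  · obtain ⟨Y, -, hY⟩ := hF.exists_hasHoelderLimit hC
    exact ⟨_, hasL2Extension_iff.2 ((hY.hasL2Limit hsm.continuousOn).congr (discExt_toDisc _).symm),
      isTangential_eichler Y⟩

/-- A vector field solving the Cauchy-Riemann equation for `q` with tangential boundary values is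
the field of a third primitive. -/
theorem exists_eq_eichlerField {q : 𝔻 → ℂ} (hq : DifferentiableOn ℂ (discExt q) disc) {C : ℝ}
    (hC : ∀ z ∈ disc, ‖discExt q z‖ * (1 - ‖z‖ ^ 2) ^ 2 ≤ C) {X : 𝔻 → ℂ}
    (hX : ContinuousOn (discExt X) disc)
    (hd : ∀ z : 𝔻, HasDbarAt (discExt X) ((1 - z * conj (z : ℂ)) ^ 2 / 4 * conj (q z)) z)
    {Y : Circle → ℂ} (hY : HasL2Limit (discExt X) Y) (ht : IsTangential Y) :
    ∃ F, IsThirdPrimitive F (discExt q) ∧ X = toDisc (eichlerField F) := by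
  obtain ⟨F, hF⟩ := exists_isThirdPrimitive hq
  obtain ⟨Y', -, hY'⟩ := hF.exists_hasHoelderLimit hC
  have hcont := (contDiffOn_eichlerField hF.1).continuousOn
  have hhol : DifferentiableOn ℂ (discExt X - eichlerField F) disc := fun z hz => by
    have h := hd (UnitDisc.mk z (mem_disc.1 hz))
    rw [UnitDisc.coe_mk, ← discExt_of_norm_lt q] at h
    have h' := h.sub (hF.hasDbarAt hz)
    rw [sub_self] at h'
    exact h'.differentiableAt.differentiableWithinAt
  obtain ⟨b, c, hc, hbc⟩ := eq_quadratic_of_isTangential hhol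
    (hY.sub (hY'.hasL2Limit hcont) hX hcont) (ht.sub (isTangential_eichler Y'))
  have hcc : conj c = -c := Complex.ext (by simp [hc]) (by simp)
  -- Since `c` is imaginary, the field of `4 b + 2 c z` is `-(b + c z - b̄ z²)`; subtracting this
  -- polynomial from `F` adds the missing Killing field.
  have hP := isThirdPrimitive_quadratic (4 * b) (2 * c) 0
  refine ⟨F - fun z => 4 * b + 2 * c * z + 0 * z ^ 2, by simpa using hF.sub hP, ?_⟩
  funext z
  have hz := coe_mem_disc z
  have h1 := hbc z hz
  have h2 := eichlerField_sub hF.1 hP.1 hz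
  have h3 := eichlerField_quadratic (4 * b) (2 * c) 0 hz
  rw [Pi.sub_apply, discExt_coe] at h1
  rw [toDisc, h2, Pi.sub_apply, h3]
  simp only [map_mul, map_zero, map_sub, map_div₀, map_ofNat, hcc]
  linear_combination h1

theorem IsPotential.exists_eq_eichlerField {q : 𝔻 → ℂ}
    (hq : DifferentiableOn ℂ (discExt q) disc) {C : ℝ}
    (hC : ∀ z ∈ disc, ‖discExt q z‖ * (1 - ‖z‖ ^ 2) ^ 2 ≤ C) {χ : 𝔻 → ℂ} (hχ : IsPotential q χ) :
    ∃ F, IsThirdPrimitive F (discExt q) ∧ χ = toDisc (eichlerField F) := by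
  obtain ⟨Y, hY, ht⟩ := hχ.boundary
  have hsm : IsSmooth χ := hχ.harmonic.1
  exact HarmonicDisc.exists_eq_eichlerField hq hC hsm.continuousOn
    (fun z => HasDbarAt.of_quadraticPart hsm (hχ.quadratic z)) hY ht

theorem toDisc_eichlerField_sub_mem_killing {F G f : ℂ → ℂ} (hF : IsThirdPrimitive F f)
    (hG : IsThirdPrimitive G f) :
    toDisc (eichlerField F) - toDisc (eichlerField G) ∈ killing := by
  have h := hF.sub hG
  rw [sub_self] at h
  obtain ⟨a, b, c, habc⟩ := h.eq_quadratic
  have he : toDisc (eichlerField F) - toDisc (eichlerField G) =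
      toDisc (eichlerField fun z => a + b * z + c * z ^ 2) :=
    (toDisc_congr ((eichlerField_sub hF.1 hG.1).symm.trans (eichlerField_congr habc)))
  rw [he]
  exact toDisc_eichlerField_quadratic_mem_killing a b c

/-- By invariance of `q`, the pulled-back third primitive is again a third primitive of `q`, and two
of these have fields differing by a Killing field. -/
theorem coboundary_eichlerField_mem_killing {Γ : Subgroup IsomPlus} {q : 𝔻 → ℂ} (hq : q ∈ HQD Γ)
    {F : ℂ → ℂ} (hF : IsThirdPrimitive F (discExt q)) {γ : IsomPlus} (hγ : γ ∈ Γ) :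
    coboundary (toDisc (eichlerField F)) γ ∈ killing := by
  obtain ⟨G, hG, hpull⟩ := hF.exists_pullback γ
  have hG' : IsThirdPrimitive G (discExt q) := ⟨hG.1, hG.2.trans fun z hz => by
    have h := hq.2 γ hγ (UnitDisc.mk z (mem_disc.1 hz))
    rw [isomDeriv, UnitDisc.coe_mk] at h
    have hm : mapExt γ.1 z = ((γ • UnitDisc.mk z (mem_disc.1 hz) : 𝔻) : ℂ) :=
      discExt_of_norm_lt _ (mem_disc.1 hz)
    simp only
    rw [discExt_of_norm_lt q (mem_disc.1 hz), ← h, hm, discExt_coe]⟩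
  rw [coboundary, hpull]
  exact toDisc_eichlerField_sub_mem_killing hG' hF

/-- The cocycle `δχ` of a vector field all of whose coboundaries are Killing fields. -/
noncomputable def coboundaryCocycle (Γ : Subgroup IsomPlus) (χ : 𝔻 → ℂ)
    (h : ∀ γ ∈ Γ, coboundary χ γ ∈ killing) : Z1 Γ :=
  ⟨fun γ => coboundary χ γ, fun γ => h γ γ.2, fun γ₁ γ₂ => coboundary_mul χ γ₁ γ₂⟩

/-! ### Injectivity -/

theorem HasHoelderLimit.unique {X : ℂ → ℂ} {Y Y' : Circle → ℂ} (h : HasHoelderLimit X Y)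
    (h' : HasHoelderLimit X Y') : Y = Y' := by
  obtain ⟨K, hK⟩ := h
  obtain ⟨K', hK'⟩ := h'
  funext w
  have hlim : ∀ {K : ℝ} {y : ℂ}, (∀ r : ℝ, 0 ≤ r → r < 1 → ‖X (r * w) - y‖ ≤ K * √(1 - r)) →
      Tendsto (fun r : ℝ => X (r * w)) (𝓝[<] 1) (𝓝 y) := fun {K y} hy => by
    rw [tendsto_iff_norm_sub_tendsto_zero]
    refine tendsto_of_tendsto_of_tendsto_of_le_of_le' tendsto_const_nhds (tendsto_sqrt_one_sub K)
      (Eventually.of_forall fun _ => norm_nonneg _) ?_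
    filter_upwards [eventually_radius] with r hr
    exact hy r hr.1.le hr.2
  exact tendsto_nhds_unique (hlim fun r h0 h1 => hK r h0 h1 w) (hlim fun r h0 h1 => hK' r h0 h1 w)

/-- A third primitive whose vector field vanishes at the boundary is a quadratic polynomial. -/
theorem eqOn_zero_of_hasHoelderLimit_zero {F f : ℂ → ℂ} (hF : IsThirdPrimitive F f) {C : ℝ}
    (hC : ∀ z ∈ disc, ‖f z‖ * (1 - ‖z‖ ^ 2) ^ 2 ≤ C)
    (h0 : HasHoelderLimit (eichlerField F) 0) : EqOn f 0 disc := by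
  obtain ⟨Y, hY, hY'⟩ := hF.exists_hasHoelderLimit hC
  have hsymm : ∀ w : Circle, (w : ℂ) ^ 2 * conj (Y w) = Y w := fun w => by
    have h := congrFun (hY'.unique h0) w
    simp only [Pi.zero_apply] at h
    linear_combination 4 * h
  -- The relation `w² Ȳ = Y` says that `w̄ Y` is real, so `i Y` is a real multiple of `i w`.
  have ht : IsTangential fun w => I * Y w := by
    refine Eventually.of_forall fun θ => ⟨(conj (Circle.exp θ : ℂ) * Y (Circle.exp θ)).re, ?_⟩
    have hs := hsymm (Circle.exp θ)
    generalize Circle.exp θ = w at *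
    have hw : (w : ℂ) * conj (w : ℂ) = 1 := by
      rw [mul_conj, normSq_eq_norm_sq, Circle.norm_coe]
      simp
    have hreal : conj (conj (w : ℂ) * Y w) = conj (w : ℂ) * Y w := by
      rw [map_mul, conj_conj]
      linear_combination conj (w : ℂ) * hs - w * conj (Y w) * hw
    rw [conj_eq_iff_re.1 hreal]
    linear_combination (-I * Y w) * hw
  obtain ⟨b, c, -, hbc⟩ := eq_quadratic_of_isTangential (hF.1.const_mul I)
    ((hY.hasL2Limit hF.1.continuousOn).const_mul I) ht
  have hq := isThirdPrimitive_quadratic (-I * b) (-I * c) (I * conj b)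
  have he : EqOn F (fun z => -I * b + -I * c * z + I * conj b * z ^ 2) disc := fun z hz => by
    linear_combination -I * hbc z hz + F z * I_mul_I
  exact fun z hz => by
    rw [← hF.2 hz, eqOn_deriv (eqOn_deriv (eqOn_deriv he)) hz, hq.2 hz]

/-- Removing `K` from `χ₁ - χ₂` leaves an invariant field, without changing the Cauchy-Riemann
equation for `q₁ - q₂`. Invariance makes it vanish at the circle, so it is the field of a third
primitive with zero boundary values, and this forces `q₁ - q₂ = 0`. -/
theorem eq_of_coboundary_sub {Γ : Subgroup IsomPlus}
    (hcocompact : CompactSpace (MulAction.orbitRel.Quotient Γ 𝔻)) {q₁ q₂ : 𝔻 → ℂ}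
    (h₁ : q₁ ∈ HQD Γ) (h₂ : q₂ ∈ HQD Γ) {χ₁ χ₂ K : 𝔻 → ℂ} (hχ₁ : IsPotential q₁ χ₁)
    (hχ₂ : IsPotential q₂ χ₂) (hK : K ∈ killing)
    (h : ∀ γ ∈ Γ, coboundary χ₁ γ - coboundary χ₂ γ = coboundary K γ) : q₁ = q₂ := by
  have hq := (HQD Γ).sub_mem h₁ h₂
  obtain ⟨C, hC⟩ := exists_bound_of_mem_HQD hcocompact hq
  have hsub : ∀ X Y : 𝔻 → ℂ, discExt (X - Y) = discExt X - discExt Y := fun X Y => by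
    rw [sub_eq_add_neg, discExt_add, ← neg_one_smul ℝ Y, discExt_smul, neg_one_smul,
      sub_eq_add_neg]
  have hs₁ : IsSmooth χ₁ := hχ₁.harmonic.1
  have hs₂ : IsSmooth χ₂ := hχ₂.harmonic.1
  have hsK : IsSmooth K := hK.1
  set X := χ₁ - χ₂ - K with hXdef
  have hXc : ContinuousOn (discExt X) disc := by
    rw [hXdef, hsub, hsub]
    exact (hs₁.continuousOn.sub hs₂.continuousOn).sub hsK.continuousOn
  have hinv : ∀ γ ∈ Γ, pullback γ X = X := fun γ hγ => by
    rw [← sub_eq_zero]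
    change coboundary X γ = 0
    rw [hXdef, coboundary_sub, coboundary_sub, h γ hγ, sub_self]
  have h0 := hasHoelderLimit_zero_of_invariant hcocompact
    (continuous_of_continuousOn_discExt hXc) hinv
  have hd : ∀ z : 𝔻, HasDbarAt (discExt X)
      ((1 - z * conj (z : ℂ)) ^ 2 / 4 * conj ((q₁ - q₂) z)) z := fun z => by
    have hd' := ((HasDbarAt.of_quadraticPart hs₁ (hχ₁.quadratic z)).sub
      (HasDbarAt.of_quadraticPart hs₂ (hχ₂.quadratic z))).sub (hasDbarAt_of_mem_killing hK z)
    rw [hXdef, hsub, hsub, Pi.sub_apply, map_sub, mul_sub]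
    rw [sub_zero] at hd'
    exact hd'
  obtain ⟨F, hF, hXF⟩ := exists_eq_eichlerField hq.1 hC hXc hd (h0.hasL2Limit hXc)
    isTangential_zero
  have h0' : HasHoelderLimit (eichlerField F) 0 := by
    obtain ⟨M, hM⟩ := h0
    refine ⟨M, fun r hr hr1 w => ?_⟩
    have hz : (r : ℂ) * w ∈ disc := by
      rw [mem_disc, norm_mul, Circle.norm_coe, norm_real, Real.norm_of_nonneg hr, mul_one]
      exact hr1
    rw [← discExt_toDisc (eichlerField F) hz, ← hXF]
    exact hM r hr hr1 w
  have hzero := eqOn_zero_of_hasHoelderLimit_zero hF hC h0'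
  rw [← sub_eq_zero]
  funext z
  rw [← discExt_coe (q₁ - q₂) z]
  exact hzero (coe_mem_disc z)

/-! ### Existence, cocycle property and uniqueness for cocompact groups -/

theorem exists_isPotential {Γ : Subgroup IsomPlus}
    (hcocompact : CompactSpace (MulAction.orbitRel.Quotient Γ 𝔻)) {q : 𝔻 → ℂ} (hq : q ∈ HQD Γ) :
    ∃ χ : 𝔻 → ℂ, IsPotential q χ := by
  obtain ⟨C, hC⟩ := exists_bound_of_mem_HQD hcocompact hq
  obtain ⟨F, hF⟩ := exists_isThirdPrimitive hq.1
  exact ⟨_, isPotential_eichlerField hq.1 hC hF⟩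

theorem IsPotential.coboundary_mem_killing {Γ : Subgroup IsomPlus}
    (hcocompact : CompactSpace (MulAction.orbitRel.Quotient Γ 𝔻)) {q χ : 𝔻 → ℂ} (hq : q ∈ HQD Γ)
    (hχ : IsPotential q χ) (γ : IsomPlus) (hγ : γ ∈ Γ) : coboundary χ γ ∈ killing := by
  obtain ⟨C, hC⟩ := exists_bound_of_mem_HQD hcocompact hq
  obtain ⟨F, hF, rfl⟩ := hχ.exists_eq_eichlerField hq.1 hC
  exact coboundary_eichlerField_mem_killing hq hF hγ

theorem IsPotential.sub_mem_killing {Γ : Subgroup IsomPlus}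
    (hcocompact : CompactSpace (MulAction.orbitRel.Quotient Γ 𝔻)) {q χ χ' : 𝔻 → ℂ}
    (hq : q ∈ HQD Γ) (hχ : IsPotential q χ) (hχ' : IsPotential q χ') : χ - χ' ∈ killing := by
  obtain ⟨C, hC⟩ := exists_bound_of_mem_HQD hcocompact hq
  obtain ⟨F, hF, rfl⟩ := hχ.exists_eq_eichlerField hq.1 hC
  obtain ⟨F', hF', rfl⟩ := hχ'.exists_eq_eichlerField hq.1 hC
  exact toDisc_eichlerField_sub_mem_killing hF hF'

end HarmonicDisc

theorem mainTheorem6 (Γ : Subgroup HarmonicDisc.IsomPlus) (hdiscrete : DiscreteTopology Γ)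
    (hcocompact : CompactSpace (MulAction.orbitRel.Quotient Γ 𝔻)) :
    (∀ q : HarmonicDisc.HQD Γ, ∃ χ : 𝔻 → ℂ, HarmonicDisc.IsPotential q χ) ∧
    ∃ Φ : HarmonicDisc.HQD Γ → HarmonicDisc.H1 Γ,
      (∀ (q : HarmonicDisc.HQD Γ) (χ : 𝔻 → ℂ), HarmonicDisc.IsPotential q χ →
        ∃ c : HarmonicDisc.Z1 Γ,
          (∀ γ : Γ, c.1 γ = HarmonicDisc.coboundary χ γ) ∧
          Φ q = Submodule.Quotient.mk c) ∧
      Function.Injective Φ := by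
  choose χ₀ hχ₀ using fun q : HarmonicDisc.HQD Γ => HarmonicDisc.exists_isPotential hcocompact q.2
  refine ⟨fun q => ⟨χ₀ q, hχ₀ q⟩,
    fun q => Submodule.Quotient.mk (HarmonicDisc.coboundaryCocycle Γ (χ₀ q)
      ((hχ₀ q).coboundary_mem_killing hcocompact q.2)),
    fun q χ hχ => ⟨HarmonicDisc.coboundaryCocycle Γ χ
      (hχ.coboundary_mem_killing hcocompact q.2), fun γ => rfl, ?_⟩, fun q₁ q₂ h => ?_⟩
  -- The chosen potential and any other differ by a Killing field, whose coboundary is the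
  -- difference of the two cocycles.
  · exact (Submodule.Quotient.eq _).2 ⟨χ₀ q - χ, (hχ₀ q).sub_mem_killing hcocompact q.2 hχ,
      fun γ => (HarmonicDisc.coboundary_sub (χ₀ q) χ γ).symm⟩
  · obtain ⟨K, hK, hc⟩ := (Submodule.Quotient.eq _).1 h
    exact Subtype.ext (HarmonicDisc.eq_of_coboundary_sub hcocompact q₁.2 q₂.2 (hχ₀ q₁) (hχ₀ q₂)
      hK fun γ hγ => hc ⟨γ, hγ⟩)
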